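/- Let $\Gamma$ be a finite connected undirected graph whose edges $\{i,j\}$ carry labels $m_{ij}\in\{3,4,5,\dots\}\cup\{\infty\}$, i.e. the Coxeter graph of a Coxeter matrix $M=(m_{ij})$ with a finite index set $B$ ($m_{ii}=1$; $m_{ij}=2$ if $i\ne j$ are not joined). For elements $x,y$ of an algebra write $(xyxy\cdots)_n$ for the alternating product of $n$ factors beginning with $x$. *Algebras.* (1) For $q\in\mathbb C$ let $H(q)$ be the Hecke algebra: the unital associative $\mathbb C$-algebra with generators $t_i$ ($i\in B$) and relations $t_i^2=(q-1)t_i+q$ and $(t_it_jt_i\cdots)_{m_{ij}}=(t_jt_it_j\cdots)_{m_{ij}}$ for $i\neq j$, $m_{ij}<\infty$. Let $TL_{\Gamma}(q)$ be the quotient of $H(q)$ by the two-sided ideal generated, for all edges $\{i,j\}$ with $m=m_{ij}<\infty$, by the elements $$1+\sum_{k=1}^{m-1}\bigl((t_it_jt_i\cdots)_k+(t_jt_it_j\cdots)_k\bigr)+(t_it_jt_i\cdots)_m,$$ that is, by the sums $\sum_w t_w$ over the finite dihedral groups $\langle s_i,s_j\rangle$. (2) For a family $\tau=(\tau_{m,k})$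 of complex numbers let $TL_{\Gamma,\tau}$ be the unital associative $\mathbb C$-algebra with generators $p_i$ ($i\in B$) and relations $p_i^2=p_i$; $p_ip_j=p_jp_i$ if $i,j$ are not joined; and, for every edge $\{i,j\}$ with $m=m_{ij}<\infty$ and in both orders of $i,j$, $$(p_ip_jp_i\cdots)_m=\sum_{1\le k\le (m-1)/2}\tau_{m,k}\,(p_ip_jp_i\cdots)_{m-2k}.$$ Thus $p_ip_jp_i=\tau_{3,1}p_i$ if $m=3$, $p_ip_jp_ip_j=\tau_{4,1}p_ip_j$ if $m=4$, and $p_ip_jp_ip_jp_i=\tau_{5,1}\,p_ip_jp_i+\tau_{5,2}\,p_i$ if $m=5$. No relation is imposed on an edge with label $\infty$. *Growth.* For a finite-dimensional subspace $V$ of an algebra put $d_V(n)=\dim(V+V^2+\dots+V^n)$. For functions $f,g:\mathbb N\to\mathbb N$ write $f\le g$ if there is $m\in\mathbb N$ with $f(n)\le g(mn)$ for all $n$, and $f\sim g$ if $f\le g$ and $g\le f$. Two algebras have the same growth if $d_V\sim d_{V'}$ for all finite-dimensional subspaces $V$ of the first and $V'$ of the second that generate them as unital algebras. **Proposition.** The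 dimension of the generalized Temperley–Lieb algebra of type $\Gamma$, and its growth when it is infinite-dimensional, do not depend on the parameter: for all $q,q'\in\mathbb C$ the algebras $TL_\Gamma(q)$ and $TL_\Gamma(q')$ have equal dimensions and, if these are infinite, the same growth; and for all families $\tau,\tau'$ the algebras $TL_{\Gamma,\tau}$ and $TL_{\Gamma,\tau'}$ have equal dimensions and, if these are infinite, the same growth. -/

import Mathlib

/-- The alternating product `x * y * x * y * ⋯` with `n` factors, the first of them `x`. -/
def altProd {A : Type*} [Monoid A] (x y : A) : ℕ → A
  | 0 => 1
  | n + 1 => x * altProd y x n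

/-- The Coxeter graph `Γ` of a Coxeter matrix: distinct `i` and `j` are joined by an edge exactly
when `m i j ≠ 2`. The edge carries the label `m i j`; Mathlib writes `0` for the label `∞`. -/
def coxeterGraph {B : Type*} (M : CoxeterMatrix B) : SimpleGraph B where
  Adj i j := i ≠ j ∧ M i j ≠ 2
  symm := ⟨fun i j h => ⟨h.1.symm, by rw [M.symmetric j i]; exact h.2⟩⟩
  loopless := ⟨fun _ h => h.1 rfl⟩

/-- Defining relations of the Hecke algebra: `t i ^ 2 = (q - 1) t i + q`, and the braid relation
with `m i j` factors on each side for `i ≠ j` and `m i j` finite. -/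
inductive HeckeRel {B : Type*} (M : CoxeterMatrix B) (q : ℂ) :
    FreeAlgebra ℂ B → FreeAlgebra ℂ B → Prop
  | quadratic (i : B) :
      HeckeRel M q (FreeAlgebra.ι ℂ i * FreeAlgebra.ι ℂ i)
        ((q - 1) • FreeAlgebra.ι ℂ i + algebraMap ℂ (FreeAlgebra ℂ B) q)
  | braid (i j : B) (hij : i ≠ j) (hfin : M i j ≠ 0) :
      HeckeRel M q (altProd (FreeAlgebra.ι ℂ i) (FreeAlgebra.ι ℂ j) (M i j))
        (altProd (FreeAlgebra.ι ℂ j) (FreeAlgebra.ι ℂ i) (M i j))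

/-- The unital Hecke algebra over `ℂ` of the Coxeter matrix `M` with parameter `q`. -/
abbrev HeckeAlgebra {B : Type*} (M : CoxeterMatrix B) (q : ℂ) : Type _ :=
  RingQuot (HeckeRel M q)

/-- The generator `t i` of the Hecke algebra. -/
noncomputable def heckeGen {B : Type*} (M : CoxeterMatrix B) (q : ℂ) (i : B) : HeckeAlgebra M q :=
  RingQuot.mkAlgHom ℂ (HeckeRel M q) (FreeAlgebra.ι ℂ i)

/-- For `x = t i`, `y = t j` and `m = m i j` finite, this is the sum of the basis elements `T w`
over all `2 m` elements `w` of the dihedral group generated by `s i` and `s j`: the identity, two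
elements of each length `1, …, m - 1`, and the longest element, of length `m`. -/
def dihedralSum {A : Type*} [Semiring A] (x y : A) (m : ℕ) : A :=
  1 + ∑ k ∈ Finset.Icc 1 (m - 1), (altProd x y k + altProd y x k) + altProd x y m

/-- The relations killing `dihedralSum (t i) (t j) (m i j)` for every edge `(i, j)` of the Coxeter
graph with a finite label. -/
inductive TLRel {B : Type*} (M : CoxeterMatrix B) (q : ℂ) :
    HeckeAlgebra M q → HeckeAlgebra M q → Prop
  | edge (i j : B) (hij : (coxeterGraph M).Adj i j) (hfin : M i j ≠ 0) :
      TLRel M q (dihedralSum (heckeGen M q i) (heckeGen M q j) (M i j)) 0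

/-- The generalized Temperley-Lieb algebra: the quotient of the Hecke algebra by the two-sided
ideal generated by the left-hand sides of `TLRel`. -/
abbrev TLAlgebra {B : Type*} (M : CoxeterMatrix B) (q : ℂ) : Type _ :=
  RingQuot (TLRel M q)

/-- Defining relations of the generalized Temperley-Lieb algebra in its idempotent generators `p i`:
`p i ^ 2 = p i`; `p i * p j = p j * p i` when `i`, `j` are not joined; and, on an edge with finite
label `m`,
`(p i p j p i ⋯)_m = ∑_{1 ≤ k ≤ (m - 1) / 2} τ m k • (p i p j p i ⋯)_{m - 2 k}`,
where a subscript is the number of factors. Thus `p i p j p i = τ p i` for `m = 3`,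
`p i p j p i p j = τ p i p j` for `m = 4`, and
`p i p j p i p j p i = τ₁ p i p j p i - τ₂ p i` for `m = 5`. -/
inductive TLProjRel {B : Type*} (M : CoxeterMatrix B) (τ : ℕ → ℕ → ℂ) :
    FreeAlgebra ℂ B → FreeAlgebra ℂ B → Prop
  | idem (i : B) :
      TLProjRel M τ (FreeAlgebra.ι ℂ i * FreeAlgebra.ι ℂ i) (FreeAlgebra.ι ℂ i)
  | comm (i j : B) (hij : ¬ (coxeterGraph M).Adj i j) :
      TLProjRel M τ (FreeAlgebra.ι ℂ i * FreeAlgebra.ι ℂ j)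
        (FreeAlgebra.ι ℂ j * FreeAlgebra.ι ℂ i)
  | edge (i j : B) (hij : (coxeterGraph M).Adj i j) (hfin : M i j ≠ 0) :
      TLProjRel M τ (altProd (FreeAlgebra.ι ℂ i) (FreeAlgebra.ι ℂ j) (M i j))
        (∑ k ∈ Finset.Icc 1 ((M i j - 1) / 2),
          τ (M i j) k • altProd (FreeAlgebra.ι ℂ i) (FreeAlgebra.ι ℂ j) (M i j - 2 * k))

/-- The generalized Temperley-Lieb algebra presented by the idempotents `p i`, with parameters `τ`:
the numbers `τ m k` occur in the relations of the edges with label `m`. -/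
abbrev TLProjAlgebra {B : Type*} (M : CoxeterMatrix B) (τ : ℕ → ℕ → ℂ) : Type _ :=
  RingQuot (TLProjRel M τ)

/-- The growth function `d_V(n) = dim (V + V ^ 2 + ⋯ + V ^ n)` of a subspace `V` of an algebra. -/
noncomputable def growthFunction {A : Type*} [Ring A] [Algebra ℂ A] (V : Submodule ℂ A) (n : ℕ) :
    ℕ :=
  Module.finrank ℂ (⨆ k ∈ Finset.Icc 1 n, V ^ k : Submodule ℂ A)

/-- The preorder on growth functions: `f ≤ g` when `f n ≤ g (m n)` for some fixed `m` and all `n`.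
-/
def GrowthLE (f g : ℕ → ℕ) : Prop :=
  ∃ m : ℕ, ∀ n : ℕ, f n ≤ g (m * n)

/-- Equivalence of growth functions; its classes are the growths. -/
def GrowthEquiv (f g : ℕ → ℕ) : Prop :=
  GrowthLE f g ∧ GrowthLE g f

/-- Two algebras have the same growth: the growth functions of any finite-dimensional generating
subspaces `V` of the first and `V'` of the second are equivalent. -/
def SameGrowth (A A' : Type*) [Ring A] [Algebra ℂ A] [Ring A'] [Algebra ℂ A'] : Prop :=
  ∀ (V : Submodule ℂ A) (V' : Submodule ℂ A'),
    FiniteDimensional ℂ V → FiniteDimensional ℂ V' →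
    Algebra.adjoin ℂ (V : Set A) = ⊤ → Algebra.adjoin ℂ (V' : Set A') = ⊤ →
    GrowthEquiv (growthFunction V) (growthFunction V')

/-- Two algebras have the same dimension and, when this is infinite, the same growth. -/
def SameDimensionAndGrowth.{u} (A A' : Type u) [Ring A] [Algebra ℂ A] [Ring A'] [Algebra ℂ A'] :
    Prop :=
  Module.rank ℂ A = Module.rank ℂ A' ∧ (¬ FiniteDimensional ℂ A → SameGrowth A A')

/-! Both kinds of algebra have presentations of one shape (`TLParams`, `IsTLFamily`): generators `x
i` with `x i ^ 2 = c • x i`, commutation of unjoined letters, and on an edge with finite label `m`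
an expression of the alternating word of length `m` by shorter ones. For the idempotents, `c = 1`.
For `TLAlgebra`, put `x i = t i + 1`, so that `c = q + 1`; the sum of the `T w` over a dihedral
group is then a polynomial in `x i`, `x j` with leading term the alternating word of length `m`
(`sum_altProd_eq_sum_klCoeff`). Its vanishing in both orders gives back the braid relation.

Read these relations as length-decreasing rewriting rules on the trace monoid, where commutation is
built in. The left-hand sides do not involve the parameters, so neither do the normal traces. If the
rules are confluent, the normal traces form a basis for every choice of parameters, and a power of
the span of `1` and the generators is spanned by the normal traces of bounded length. Matching the
bases then matches these filtrations, hence dimension and growth.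

Confluence holds without any condition on the coefficients because the right-hand sides have no
constant term and contain only lengths of the parity of `m`: all words in a rule begin with the same
letter and end with the same letter. Levi's lemma leaves four positions of two left-hand sides.
Disjoint ones commute. If they share one end letter, each rule leaves that letter in place, so they
again act independently. If they share at least two letters they use the same two letters, and both
results are equal term by term. The last position is special to traces: `i j i` and `i' j i'`
sharing only the middle `j`, with `i`, `i'` commuting; one more use of the quadratic rule settles
it. All this is `reduct_sub_reduct_mem`, from which `exists_normalization` and
`IsTLFamily.exists_basis` follow as in Bergman's diamond lemma. -/

/-! ### Trace monoids and Levi's lemma -/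

section TraceMonoid

variable {B : Type*}

/-- The relations of the trace monoid: letters `i` and `j` with `M i j = 2` commute. -/
def traceRel (M : CoxeterMatrix B) (x y : FreeMonoid B) : Prop :=
  ∃ i j, M i j = 2 ∧ x = FreeMonoid.of i * FreeMonoid.of j ∧
    y = FreeMonoid.of j * FreeMonoid.of i

/-- The trace monoid of a Coxeter matrix: words in `B` modulo the commutation of the pairs of
letters that are not joined in the Coxeter graph. -/
abbrev TraceMonoid (M : CoxeterMatrix B) : Type _ := PresentedMonoid (traceRel M)

namespace TraceMonoid

variable {M : CoxeterMatrix B}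

/-- The trace of a word. -/
def ofWord (M : CoxeterMatrix B) (l : List B) : TraceMonoid M :=
  PresentedMonoid.mk (traceRel M) (FreeMonoid.ofList l)

/-- The trace of a letter. -/
def gen (M : CoxeterMatrix B) (i : B) : TraceMonoid M := PresentedMonoid.of (traceRel M) i

@[simp] theorem ofWord_nil : ofWord M [] = 1 := rfl

theorem ofWord_cons (i : B) (l : List B) : ofWord M (i :: l) = gen M i * ofWord M l := rfl

theorem ofWord_append (l l' : List B) : ofWord M (l ++ l') = ofWord M l * ofWord M l' := rfl

theorem ofWord_surjective : Function.Surjective (ofWord M) := fun t =>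
  PresentedMonoid.surjective_mk t

theorem gen_mul_gen {i j : B} (h : M i j = 2) : gen M i * gen M j = gen M j * gen M i :=
  PresentedMonoid.mk_eq_mk_of_rel ⟨i, j, h, rfl, rfl⟩

@[elab_as_elim]
theorem induction {p : TraceMonoid M → Prop} (t : TraceMonoid M) (one : p 1)
    (mul : ∀ i t, p t → p (gen M i * t)) : p t := by
  obtain ⟨l, rfl⟩ := ofWord_surjective t
  induction l with
  | nil => exact one
  | cons i l ih => exact mul i _ ih

/-- The multiset of letters of a trace, as a monoid homomorphism. -/
def contentHom (M : CoxeterMatrix B) : TraceMonoid M →* Multiplicative (Multiset B) :=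
  PresentedMonoid.lift (fun i => Multiplicative.ofAdd {i}) (by
    rintro a b ⟨i, j, -, rfl, rfl⟩
    simp [mul_comm])

/-- The multiset of letters of a trace. -/
def content (t : TraceMonoid M) : Multiset B := (contentHom M t).toAdd

/-- The number of letters of a trace. -/
def len (t : TraceMonoid M) : ℕ := t.content.card

@[simp] theorem content_one : content (1 : TraceMonoid M) = 0 := by simp [content]

@[simp] theorem content_mul (x y : TraceMonoid M) : content (x * y) = content x + content y := by
  simp [content]

@[simp] theorem content_gen (i : B) : content (gen M i) = {i} := rfl

@[simp] theorem len_one : len (1 : TraceMonoid M) = 0 := by simp [len]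

@[simp] theorem len_mul (x y : TraceMonoid M) : len (x * y) = len x + len y := by simp [len]

@[simp] theorem len_gen (i : B) : len (gen M i) = 1 := rfl

theorem len_ofWord (l : List B) : len (ofWord M l) = l.length := by
  induction l with
  | nil => simp
  | cons i l ih => rw [ofWord_cons, len_mul, ih, len_gen, List.length_cons, add_comm]

theorem mem_content_ofWord {l : List B} {i : B} : i ∈ content (ofWord M l) ↔ i ∈ l := by
  induction l with
  | nil => simp
  | cons j l ih => rw [ofWord_cons, content_mul, Multiset.mem_add, ih]; simp

/-- Two traces are independent when each letter of the first commutes with each of the second. -/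
def Ind (x y : TraceMonoid M) : Prop := ∀ i ∈ content x, ∀ j ∈ content y, M i j = 2

theorem Ind.symm {x y : TraceMonoid M} (h : Ind x y) : Ind y x := fun i hi j hj => by
  rw [M.symmetric]; exact h j hj i hi

@[simp] theorem ind_one_left (x : TraceMonoid M) : Ind 1 x := fun i hi => by simp at hi

@[simp] theorem ind_one_right (x : TraceMonoid M) : Ind x 1 := fun i _ j hj => by simp at hj

theorem ind_mul_left {x y z : TraceMonoid M} : Ind (x * y) z ↔ Ind x z ∧ Ind y z := by
  simp only [Ind, content_mul, Multiset.mem_add, or_imp, forall_and]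

theorem ind_mul_right {x y z : TraceMonoid M} : Ind x (y * z) ↔ Ind x y ∧ Ind x z := by
  simp only [Ind, content_mul, Multiset.mem_add, or_imp, forall_and]

theorem ind_gen {i j : B} : Ind (gen M i) (gen M j) ↔ M i j = 2 := by simp [Ind]

theorem Ind.mono {x y x' y' : TraceMonoid M} (h : Ind x y) (hx : content x' ⊆ content x)
    (hy : content y' ⊆ content y) : Ind x' y' :=
  fun i hi j hj => h i (hx hi) j (hy hj)

theorem Ind.mul_comm {x y : TraceMonoid M} (h : Ind x y) : x * y = y * x := by
  induction x using TraceMonoid.induction with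
  | one => simp
  | mul i x ih =>
    rw [ind_mul_left] at h
    have key : gen M i * y = y * gen M i := by
      have h1 := h.1
      clear ih h
      induction y using TraceMonoid.induction with
      | one => simp
      | mul j y ih =>
        rw [ind_mul_right, ind_gen] at h1
        rw [← mul_assoc, gen_mul_gen h1.1, mul_assoc, ih h1.2, mul_assoc]
    rw [mul_assoc, ih h.2, ← mul_assoc, key, mul_assoc]

/-- `Split l z w`: the word `l` is a shuffle of words for `z` and `w` in which no letter of `z`
has to be moved past a letter of `w` that it does not commute with. -/
def Split : List B → TraceMonoid M → TraceMonoid M → Prop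
  | [], z, w => z = 1 ∧ w = 1
  | i :: l, z, w => (∃ z', z = gen M i * z' ∧ Split l z' w) ∨
      ∃ w', w = gen M i * w' ∧ Ind (gen M i) z ∧ Split l z w'

/-- Cutting the word cuts both parts of the shuffle; the one new condition is that the part of `w`
taken from `l` passes the part of `z` taken from `l'`. -/
theorem split_append {l l' : List B} {z w : TraceMonoid M} :
    Split (l ++ l') z w ↔ ∃ p q r s, Split l p q ∧ Split l' r s ∧ z = p * r ∧ w = q * s ∧
      Ind q r := by
  induction l generalizing z w with
  | nil =>
    constructor
    · intro h
      exact ⟨1, 1, z, w, ⟨rfl, rfl⟩, h, by simp, by simp, by simp⟩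
    · rintro ⟨p, q, r, s, ⟨rfl, rfl⟩, h, rfl, rfl, -⟩
      simpa using h
  | cons i l ih =>
    rw [List.cons_append]
    constructor
    · rintro (⟨z', rfl, h⟩ | ⟨w', rfl, hi, h⟩)
      · obtain ⟨p, q, r, s, h1, h2, rfl, rfl, h3⟩ := ih.1 h
        exact ⟨gen M i * p, q, r, s, Or.inl ⟨p, rfl, h1⟩, h2, by rw [mul_assoc], rfl, h3⟩
      · obtain ⟨p, q, r, s, h1, h2, rfl, rfl, h3⟩ := ih.1 h
        rw [ind_mul_right] at hi
        exact ⟨p, gen M i * q, r, s, Or.inr ⟨q, rfl, hi.1, h1⟩, h2, rfl, by rw [mul_assoc],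
          ind_mul_left.2 ⟨hi.2, h3⟩⟩
    · rintro ⟨p, q, r, s, h1 | h1, h2, rfl, rfl, h3⟩
      · obtain ⟨p', rfl, h1⟩ := h1
        exact Or.inl ⟨p' * r, by rw [mul_assoc], ih.2 ⟨p', q, r, s, h1, h2, rfl, rfl, h3⟩⟩
      · obtain ⟨q', rfl, hi, h1⟩ := h1
        rw [ind_mul_left] at h3
        exact Or.inr ⟨q' * s, by rw [mul_assoc], ind_mul_right.2 ⟨hi, h3.1⟩,
          ih.2 ⟨p, q', r, s, h1, h2, rfl, rfl, h3.2⟩⟩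

theorem split_swap {i j : B} (hij : M i j = 2) {z w : TraceMonoid M} (h : Split [i, j] z w) :
    Split [j, i] z w := by
  have hji : M j i = 2 := by rw [M.symmetric]; exact hij
  simp only [Split] at h ⊢
  rcases h with ⟨z', rfl, ⟨z'', rfl, rfl, rfl⟩ | ⟨w', rfl, hi, rfl, rfl⟩⟩ |
    ⟨w', rfl, hi, ⟨z'', rfl, rfl, rfl⟩ | ⟨w'', rfl, hi', rfl, rfl⟩⟩
  · exact Or.inl ⟨gen M i, by simp [gen_mul_gen hij], Or.inl ⟨1, by simp⟩⟩
  · exact Or.inr ⟨1, by simp, by simpa [ind_gen] using hji, Or.inl ⟨1, by simp⟩⟩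
  · exact Or.inl ⟨1, by simp, Or.inr ⟨1, by simp⟩⟩
  · exact Or.inr ⟨gen M i, by simp [gen_mul_gen hij], by simp, Or.inr ⟨1, by simp⟩⟩

/-- The point of `Split`: it is defined on words by recursion but invariant under commutations, so a
factorization `z * w` of a trace can be read off on any word representing it. -/
theorem split_congr {l l' : List B} (h : ofWord M l = ofWord M l') {z w : TraceMonoid M} :
    Split l z w ↔ Split l' z w := by
  have h' := PresentedMonoid.mk_eq_mk_iff.1 h
  suffices ∀ x y : FreeMonoid B, ConGen.Rel (traceRel M) x y →
      ∀ z w : TraceMonoid M, Split x.toList z w ↔ Split y.toList z w from this _ _ h' z w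
  clear h h'
  intro x y h
  induction h with
  | of x y h =>
    obtain ⟨i, j, hij, rfl, rfl⟩ := h
    intro z w
    exact ⟨split_swap hij, split_swap (by rw [M.symmetric]; exact hij)⟩
  | refl x => exact fun z w => Iff.rfl
  | symm _ ih => exact fun z w => (ih z w).symm
  | trans _ _ ih ih' => exact fun z w => (ih z w).trans (ih' z w)
  | mul _ _ ih ih' =>
    intro z w
    rw [FreeMonoid.toList_mul, FreeMonoid.toList_mul, split_append, split_append]
    simp only [ih, ih']

theorem split_left (l : List B) : Split l (ofWord M l) 1 := by
  induction l with
  | nil => exact ⟨rfl, rfl⟩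
  | cons i l ih => exact Or.inl ⟨_, rfl, ih⟩

theorem split_right (l : List B) : Split l 1 (ofWord M l) := by
  induction l with
  | nil => exact ⟨rfl, rfl⟩
  | cons i l ih => exact Or.inr ⟨_, rfl, by simp, ih⟩

theorem split_self (l l' : List B) : Split (l ++ l') (ofWord M l) (ofWord M l') :=
  split_append.2 ⟨_, _, _, _, split_left l, split_right l', by simp, by simp, by simp⟩

theorem Split.ofWord_eq {l : List B} {z w : TraceMonoid M} (h : Split l z w) :
    ofWord M l = z * w := by
  induction l generalizing z w with
  | nil => obtain ⟨rfl, rfl⟩ := h; simp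
  | cons i l ih =>
    rcases h with ⟨z', rfl, h⟩ | ⟨w', rfl, hi, h⟩
    · rw [ofWord_cons, ih h, mul_assoc]
    · rw [ofWord_cons, ih h, ← mul_assoc, hi.mul_comm, mul_assoc]

/-- Levi's lemma for traces. -/
theorem levi {x y z w : TraceMonoid M} (h : x * y = z * w) :
    ∃ p q r s, x = p * q ∧ y = r * s ∧ z = p * r ∧ w = q * s ∧ Ind q r := by
  obtain ⟨x, rfl⟩ := ofWord_surjective x
  obtain ⟨y, rfl⟩ := ofWord_surjective y
  obtain ⟨z, rfl⟩ := ofWord_surjective z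
  obtain ⟨w, rfl⟩ := ofWord_surjective w
  rw [← ofWord_append, ← ofWord_append] at h
  -- The factorization `z * w` is transported to the word for `x * y` and then cut between `x` and
  -- `y`.
  obtain ⟨p, q, r, s, h1, h2, h3, h4, h5⟩ := split_append.1 ((split_congr h).2 (split_self z w))
  exact ⟨p, q, r, s, h1.ofWord_eq, h2.ofWord_eq, h3, h4, h5⟩

/-- A refinement of two factorizations of a trace into three factors. -/
theorem levi₃ {a r b a' r' b' : TraceMonoid M} (h : a * r * b = a' * r' * b') :
    ∃ a₁ a₂ a₃ r₁ r₂ r₃ b₁ b₂ b₃, a = a₁ * a₂ * a₃ ∧ r = r₁ * r₂ * r₃ ∧ b = b₁ * b₂ * b₃ ∧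
      a' = a₁ * r₁ * b₁ ∧ r' = a₂ * r₂ * b₂ ∧ b' = a₃ * r₃ * b₃ ∧
      Ind a₂ r₁ ∧ Ind a₂ b₁ ∧ Ind a₃ r₁ ∧ Ind a₃ r₂ ∧ Ind a₃ b₁ ∧ Ind a₃ b₂ ∧
      Ind r₂ b₁ ∧ Ind r₃ b₁ ∧ Ind r₃ b₂ := by
  rw [mul_assoc, mul_assoc] at h
  obtain ⟨a₁, a', ra, rb, rfl, h1, rfl, h2, h3⟩ := levi h
  obtain ⟨a₂, a₃, x, y, rfl, rfl, rfl, rfl, h4⟩ := levi h2.symm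
  obtain ⟨r₁, r', b₁, b', rfl, rfl, rfl, h5, h6⟩ := levi h1
  obtain ⟨r₂, r₃, b₂, b₃, rfl, rfl, rfl, rfl, h7⟩ := levi h5.symm
  simp only [ind_mul_left, ind_mul_right] at h3 h4 h6
  refine ⟨a₁, a₂, a₃, r₁, r₂, r₃, b₁, b₂, b₃, ?_⟩
  simp only [mul_assoc, true_and]
  tauto

/-- A word whose letters are pairwise dependent has only the obvious factorizations. -/
theorem eq_append_of_ofWord_eq_mul {l : List B} (hl : ∀ i ∈ l, ∀ j ∈ l, M i j ≠ 2)
    {z w : TraceMonoid M} (h : ofWord M l = z * w) :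
    ∃ l₁ l₂, l = l₁ ++ l₂ ∧ z = ofWord M l₁ ∧ w = ofWord M l₂ := by
  obtain ⟨z', rfl⟩ := ofWord_surjective z
  obtain ⟨w', rfl⟩ := ofWord_surjective w
  rw [← ofWord_append] at h
  have hs := (split_congr h).2 (split_self z' w')
  revert hs
  generalize ofWord M z' = z
  generalize ofWord M w' = w
  intro hs
  clear h
  induction l generalizing z w with
  | nil => exact ⟨[], [], rfl, hs.1, hs.2⟩
  | cons i l ih =>
    have hl' : ∀ i ∈ l, ∀ j ∈ l, M i j ≠ 2 := fun i hi j hj =>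
      hl i (List.mem_cons_of_mem _ hi) j (List.mem_cons_of_mem _ hj)
    rcases hs with ⟨z', rfl, h⟩ | ⟨w', rfl, hi, h⟩
    · obtain ⟨l₁, l₂, rfl, rfl, rfl⟩ := ih hl' _ _ h
      exact ⟨i :: l₁, l₂, rfl, rfl, rfl⟩
    · obtain ⟨l₁, l₂, rfl, rfl, rfl⟩ := ih hl' _ _ h
      cases l₁ with
      | nil => exact ⟨[], i :: l₂, rfl, rfl, rfl⟩
      -- Here a letter of `w` precedes a letter of `z` in the word, which would force the two to
      -- commute.
      | cons j l₁ => exact absurd (hi i (by simp) j (by simp [ofWord_cons])) (hl i (by simp) j (by simp))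

theorem ofWord_injOn {l l' : List B} (hl : ∀ i ∈ l, ∀ j ∈ l, M i j ≠ 2)
    (h : ofWord M l = ofWord M l') : l = l' := by
  induction l' generalizing l with
  | nil =>
    have := congrArg len h
    rw [len_ofWord, len_ofWord] at this
    simpa using this
  | cons i l' ih =>
    rw [ofWord_cons] at h
    obtain ⟨l₁, l₂, rfl, h1, h2⟩ := eq_append_of_ofWord_eq_mul hl h
    have h3 := congrArg len h1
    rw [len_ofWord, len_gen] at h3
    obtain ⟨j, rfl⟩ := List.length_eq_one_iff.1 h3.symm
    have h4 : i ∈ content (gen M i) := by simp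
    rw [h1, mem_content_ofWord] at h4
    obtain rfl : i = j := by simpa using h4
    rw [← ih (fun i hi j hj => hl i (List.mem_append_right _ hi) j (List.mem_append_right _ hj))
      h2.symm]
    rfl

end TraceMonoid

end TraceMonoid
-- Alternating words and their factors
section Alternating

variable {B : Type*} {M : CoxeterMatrix B}

theorem map_altProd {A A' F : Type*} [Monoid A] [Monoid A'] [FunLike F A A'] [MonoidHomClass F A A']
    (f : F) (x y : A) (n : ℕ) : f (altProd x y n) = altProd (f x) (f y) n := by
  induction n generalizing x y with
  | zero => simp [altProd]
  | succ n ih => simp [altProd, ih]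

/-- The letter at position `n` of the alternating word `i, j, i, j, …`. -/
def altLetter (i j : B) (n : ℕ) : B := if Even n then i else j

@[simp] theorem altLetter_zero (i j : B) : altLetter i j 0 = i := by simp [altLetter]

theorem altLetter_succ (i j : B) (n : ℕ) : altLetter i j (n + 1) = altLetter j i n := by
  by_cases h : Even n <;> simp [altLetter, h, Nat.even_add_one]

@[simp] theorem altLetter_self (i : B) (n : ℕ) : altLetter i i n = i := by simp [altLetter]

theorem altLetter_altLetter (i j : B) (m n : ℕ) :
    altLetter (altLetter i j m) (altLetter j i m) n = altLetter i j (m + n) := by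
  by_cases h : Even m <;> by_cases h' : Even n <;> simp [altLetter, h, h', Nat.even_add]

theorem altLetter_congr (i j : B) {m n : ℕ} (h : Even m ↔ Even n) :
    altLetter i j m = altLetter i j n := by simp [altLetter, h]

theorem altLetter_eq_or (i j : B) (n : ℕ) : altLetter i j n = i ∨ altLetter i j n = j := by
  by_cases h : Even n <;> simp [altLetter, h]

theorem altProd_add {A : Type*} [Monoid A] (f : B → A) (i j : B) (m n : ℕ) :
    altProd (f i) (f j) (m + n) =
      altProd (f i) (f j) m * altProd (f (altLetter i j m)) (f (altLetter j i m)) n := by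
  induction m generalizing i j with
  | zero => simp [altProd]
  | succ m ih =>
    rw [Nat.add_right_comm, altProd, altProd, ih, altLetter_succ, altLetter_succ, mul_assoc]

namespace TraceMonoid

/-- The alternating word `i, j, i, j, …` with `n` letters. -/
def altWord : B → B → ℕ → List B
  | _, _, 0 => []
  | i, j, n + 1 => i :: altWord j i n

theorem mem_altWord {i j k : B} {n : ℕ} :
    k ∈ altWord i j n ↔ (1 ≤ n ∧ k = i) ∨ (2 ≤ n ∧ k = j) := by
  induction n generalizing i j with
  | zero => simp [altWord]
  | succ n ih =>
    rw [altWord, List.mem_cons, ih]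
    constructor
    · rintro (rfl | ⟨h, rfl⟩ | ⟨h, rfl⟩)
      · exact Or.inl ⟨by omega, rfl⟩
      · exact Or.inr ⟨by omega, rfl⟩
      · exact Or.inl ⟨by omega, rfl⟩
    · rintro (⟨h, rfl⟩ | ⟨h, rfl⟩)
      · exact Or.inl rfl
      · exact Or.inr (Or.inl ⟨by omega, rfl⟩)

theorem length_altWord (i j : B) (n : ℕ) : (altWord i j n).length = n := by
  induction n generalizing i j with
  | zero => rfl
  | succ n ih => simp [altWord, ih]

theorem altWord_eq_append {i j : B} {n : ℕ} {l l' : List B} (h : altWord i j n = l ++ l') :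
    ∃ p q, n = p + q ∧ l = altWord i j p ∧ l' = altWord (altLetter i j p) (altLetter j i p) q := by
  induction l generalizing i j n with
  | nil => exact ⟨0, n, by simp, rfl, by simpa using h.symm⟩
  | cons k l ih =>
    cases n with
    | zero => simp [altWord] at h
    | succ n =>
      rw [altWord, List.cons_append, List.cons.injEq] at h
      obtain ⟨rfl, h⟩ := h
      obtain ⟨p, q, rfl, rfl, rfl⟩ := ih h
      exact ⟨p + 1, q, by omega, rfl, by simp [altLetter_succ]⟩

/-- The alternating trace `i * j * i * ⋯` with `n` letters. -/
def alt (M : CoxeterMatrix B) (i j : B) (n : ℕ) : TraceMonoid M := altProd (gen M i) (gen M j) n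

theorem alt_eq_ofWord (i j : B) (n : ℕ) : alt M i j n = ofWord M (altWord i j n) := by
  unfold alt
  induction n generalizing i j with
  | zero => rfl
  | succ n ih => rw [altProd, ih, altWord, ofWord_cons]

@[simp] theorem alt_zero (i j : B) : alt M i j 0 = 1 := rfl

theorem alt_succ (i j : B) (n : ℕ) : alt M i j (n + 1) = gen M i * alt M j i n := rfl

@[simp] theorem alt_one (i j : B) : alt M i j 1 = gen M i := by simp [alt_succ]

theorem alt_add (i j : B) (m n : ℕ) :
    alt M i j (m + n) = alt M i j m * alt M (altLetter i j m) (altLetter j i m) n :=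
  altProd_add (gen M) i j m n

@[simp] theorem len_alt (i j : B) (n : ℕ) : len (alt M i j n) = n := by
  rw [alt_eq_ofWord, len_ofWord, length_altWord]

theorem mem_content_alt {i j k : B} {n : ℕ} :
    k ∈ content (alt M i j n) ↔ (1 ≤ n ∧ k = i) ∨ (2 ≤ n ∧ k = j) := by
  rw [alt_eq_ofWord, mem_content_ofWord, mem_altWord]

theorem content_alt_subset (i j : B) {m n : ℕ} (h : m ≤ n) :
    content (alt M i j m) ⊆ content (alt M i j n) := by
  intro k
  rw [mem_content_alt, mem_content_alt]
  rintro (⟨h, rfl⟩ | ⟨h, rfl⟩)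
  · exact Or.inl ⟨by omega, rfl⟩
  · exact Or.inr ⟨by omega, rfl⟩

theorem dependent_of_mem_altWord {i j : B} (hij : M i j ≠ 2) (n : ℕ) :
    ∀ k ∈ altWord i j n, ∀ l ∈ altWord i j n, M k l ≠ 2 := by
  have hji : M j i ≠ 2 := by rwa [M.symmetric]
  intro k hk l hl
  rw [mem_altWord] at hk hl
  rcases hk with ⟨-, rfl⟩ | ⟨-, rfl⟩ <;> rcases hl with ⟨-, rfl⟩ | ⟨-, rfl⟩ <;> simp [*]

theorem alt_eq_mul {i j : B} (hij : M i j ≠ 2) {n : ℕ} {x y : TraceMonoid M}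
    (h : alt M i j n = x * y) :
    ∃ p q, n = p + q ∧ x = alt M i j p ∧ y = alt M (altLetter i j p) (altLetter j i p) q := by
  rw [alt_eq_ofWord] at h
  obtain ⟨l, l', hl, rfl, rfl⟩ := eq_append_of_ofWord_eq_mul (dependent_of_mem_altWord hij n) h
  obtain ⟨p, q, rfl, rfl, rfl⟩ := altWord_eq_append hl
  exact ⟨p, q, rfl, (alt_eq_ofWord ..).symm, (alt_eq_ofWord ..).symm⟩

theorem alt_eq_mul_mul {i j : B} (hij : M i j ≠ 2) {n : ℕ} {x y z : TraceMonoid M}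
    (h : alt M i j n = x * y * z) :
    ∃ p q r, n = p + q + r ∧ x = alt M i j p ∧ y = alt M (altLetter i j p) (altLetter j i p) q ∧
      z = alt M (altLetter i j (p + q)) (altLetter j i (p + q)) r := by
  obtain ⟨k, r, rfl, hk, rfl⟩ := alt_eq_mul hij h
  obtain ⟨p, q, rfl, rfl, rfl⟩ := alt_eq_mul hij hk.symm
  exact ⟨p, q, r, rfl, rfl, rfl, rfl⟩

theorem alt_inj {i j i' j' : B} (hij : M i j ≠ 2) {n n' : ℕ} (h : alt M i j n = alt M i' j' n') :
    n = n' ∧ (1 ≤ n → i = i') ∧ (2 ≤ n → j = j') := by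
  rw [alt_eq_ofWord, alt_eq_ofWord] at h
  have h := ofWord_injOn (dependent_of_mem_altWord hij n) h
  obtain rfl : n = n' := by
    have := congrArg List.length h
    rwa [length_altWord, length_altWord] at this
  refine ⟨rfl, fun hn => ?_, fun hn => ?_⟩
  · obtain ⟨k, rfl⟩ := Nat.exists_eq_add_of_le' hn
    exact (List.cons.inj h).1
  · obtain ⟨k, rfl⟩ := Nat.exists_eq_add_of_le' hn
    exact (List.cons.inj (List.cons.inj h).2).1

end TraceMonoid

end Alternating

/-! ### Rewriting rules -/

section Rules

open TraceMonoid

variable {B : Type*} (M : CoxeterMatrix B)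

/-- Parameters of the presentation `x i ^ 2 = c • x i`,
`(x i x j x i ⋯)_m = ∑ e < m, d m e • (x i x j x i ⋯)_e`. -/
structure TLParams where
  /-- the coefficient of the quadratic relation -/
  c : ℂ
  /-- the coefficients of the relations of the edges -/
  d : ℕ → ℕ → ℂ
  d_zero : ∀ m, d m 0 = 0
  parity : ∀ m e, d m e ≠ 0 → (Even e ↔ Even m)

/-- The pairs `(i, j)` that index a reduction: `i = j`, or an edge with a finite label. -/
def IsRule (i j : B) : Prop := M i j ≠ 2 ∧ M i j ≠ 0

open Classical in
/-- The length of the left-hand side of the reduction indexed by `(i, j)`. -/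
noncomputable def ruleLen (i j : B) : ℕ := if i = j then 2 else M i j

open Classical in
/-- The coefficients of the right-hand side of the reduction indexed by `(i, j)`. -/
noncomputable def ruleCoeff (P : TLParams) (i j : B) (e : ℕ) : ℂ :=
  if i = j then if e = 1 then P.c else 0 else P.d (M i j) e

/-- The right-hand side of the reduction indexed by `(i, j)` in the context `a`, `b`. -/
noncomputable def reduct (P : TLParams) (a : TraceMonoid M) (i j : B) (b : TraceMonoid M) :
    TraceMonoid M →₀ ℂ :=
  ∑ e ∈ Finset.range (ruleLen M i j),
    ruleCoeff M P i j e • Finsupp.single (a * alt M i j e * b) 1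

/-- The span of the differences of the two sides of all reductions in contexts of total length at
most `n`. -/
noncomputable def relSpan (P : TLParams) (n : ℕ) : Submodule ℂ (TraceMonoid M →₀ ℂ) :=
  Submodule.span ℂ {x | ∃ a b i j, IsRule M i j ∧ len (a * alt M i j (ruleLen M i j) * b) ≤ n ∧
    x = Finsupp.single (a * alt M i j (ruleLen M i j) * b) 1 - reduct M P a i j b}

variable {M} {P : TLParams}

theorem IsRule.symm {i j : B} (h : IsRule M i j) : IsRule M j i := by
  rwa [IsRule, M.symmetric]

theorem isRule_self (i : B) : IsRule M i i := by simp [IsRule]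

theorem ruleLen_self (i : B) : ruleLen M i i = 2 := by simp [ruleLen]

theorem ruleLen_of_ne {i j : B} (h : i ≠ j) : ruleLen M i j = M i j := by simp [ruleLen, h]

theorem ruleLen_symm (i j : B) : ruleLen M i j = ruleLen M j i := by
  by_cases h : i = j
  · rw [h]
  · rw [ruleLen_of_ne h, ruleLen_of_ne (Ne.symm h), M.symmetric]

theorem IsRule.three_le {i j : B} (h : IsRule M i j) (hij : i ≠ j) : 3 ≤ ruleLen M i j := by
  rw [ruleLen_of_ne hij]
  have := M.off_diagonal i j hij
  have := h.1
  have := h.2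
  omega

theorem IsRule.two_le {i j : B} (h : IsRule M i j) : 2 ≤ ruleLen M i j := by
  by_cases hij : i = j
  · rw [hij, ruleLen_self]
  · exact (by omega : 2 ≤ 3).trans (h.three_le hij)

theorem ruleCoeff_symm (i j : B) : ruleCoeff M P i j = ruleCoeff M P j i := by
  ext e
  by_cases h : i = j
  · rw [h]
  · simp [ruleCoeff, h, Ne.symm h, M.symmetric]

variable (M P) in
/-- The lengths of the alternating words that occur in the reduction indexed by `(i, j)`. -/
def RuleTerm (i j : B) (e : ℕ) : Prop :=
  e = ruleLen M i j ∨ e < ruleLen M i j ∧ ruleCoeff M P i j e ≠ 0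

theorem RuleTerm.le {i j : B} {e : ℕ} (h : RuleTerm M P i j e) : e ≤ ruleLen M i j := by
  rcases h with h | h <;> omega

/-- By `d_zero` no rule has a constant term, so every word in it begins with `i`. -/
theorem RuleTerm.one_le {i j : B} (hij : IsRule M i j) {e : ℕ} (h : RuleTerm M P i j e) :
    1 ≤ e := by
  rcases h with rfl | h
  · exact le_of_lt hij.two_le
  · rw [Nat.one_le_iff_ne_zero]
    rintro rfl
    simp [ruleCoeff, P.d_zero] at h

/-- By parity, continuing an alternating word beyond its end gives the same letters for every term
of a rule; in particular all terms have the same last letter. -/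
theorem RuleTerm.altLetter_eq {i j : B} {e : ℕ} (h : RuleTerm M P i j e) (n : ℕ) :
    altLetter i j (e + n) = altLetter i j (ruleLen M i j + n) := by
  by_cases hij : i = j
  · simp [hij]
  · rcases h with rfl | h
    · rfl
    · apply altLetter_congr
      rw [ruleLen_of_ne hij, Nat.even_add, Nat.even_add, P.parity (M i j) e]
      simpa [ruleCoeff, hij] using h.2

theorem sub_mem_relSpan {n : ℕ} {a b : TraceMonoid M} {i j : B} (h : IsRule M i j)
    (hn : len (a * alt M i j (ruleLen M i j) * b) ≤ n) :
    Finsupp.single (a * alt M i j (ruleLen M i j) * b) 1 - reduct M P a i j b ∈ relSpan M P n :=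
  Submodule.subset_span ⟨a, b, i, j, h, hn, rfl⟩

theorem relSpan_mono {m n : ℕ} (h : m ≤ n) : relSpan M P m ≤ relSpan M P n := by
  apply Submodule.span_mono
  rintro x ⟨a, b, i, j, h1, h2, rfl⟩
  exact ⟨a, b, i, j, h1, h2.trans h, rfl⟩

theorem reduct_congr {a b : TraceMonoid M} {i j : B} {U : ℕ → TraceMonoid M}
    (h : ∀ e, RuleTerm M P i j e → a * alt M i j e * b = U e) :
    reduct M P a i j b =
      ∑ e ∈ Finset.range (ruleLen M i j), ruleCoeff M P i j e • Finsupp.single (U e) 1 := by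
  apply Finset.sum_congr rfl
  intro e he
  by_cases h0 : ruleCoeff M P i j e = 0
  · simp [h0]
  · rw [h e (Or.inr ⟨Finset.mem_range.1 he, h0⟩)]

/-- Two reductions that can be carried out independently of each other commute. -/
theorem sum_sub_sum_mem_relSpan {n : ℕ} {i j i' j' : B} (h : IsRule M i j) (h' : IsRule M i' j')
    {U : ℕ → ℕ → TraceMonoid M}
    (hn : ∀ e < ruleLen M i j, RuleTerm M P i j e → len (U e (ruleLen M i' j')) ≤ n)
    (hn' : ∀ e < ruleLen M i' j', RuleTerm M P i' j' e → len (U (ruleLen M i j) e) ≤ n)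
    (hU : ∀ e, RuleTerm M P i j e → ∃ a b, ∀ e', RuleTerm M P i' j' e' →
      a * alt M i' j' e' * b = U e e')
    (hU' : ∀ e', RuleTerm M P i' j' e' → ∃ a b, ∀ e, RuleTerm M P i j e →
      a * alt M i j e * b = U e e') :
    ∑ e ∈ Finset.range (ruleLen M i j),
        ruleCoeff M P i j e • Finsupp.single (U e (ruleLen M i' j')) 1 -
      ∑ e ∈ Finset.range (ruleLen M i' j'),
        ruleCoeff M P i' j' e • Finsupp.single (U (ruleLen M i j) e) 1 ∈ relSpan M P n := by
  -- `S` is the result of applying both rules; each single reduction differs from it by relations of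
  -- bounded length.
  set S : TraceMonoid M →₀ ℂ := ∑ e ∈ Finset.range (ruleLen M i j),
    ∑ e' ∈ Finset.range (ruleLen M i' j'),
      (ruleCoeff M P i j e * ruleCoeff M P i' j' e') • Finsupp.single (U e e') 1 with hS
  have h1 : ∑ e ∈ Finset.range (ruleLen M i j),
      ruleCoeff M P i j e • Finsupp.single (U e (ruleLen M i' j')) 1 - S ∈ relSpan M P n := by
    rw [hS, ← Finset.sum_sub_distrib]
    refine Submodule.sum_mem _ fun e he => ?_
    by_cases h0 : ruleCoeff M P i j e = 0
    · simp [h0]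
    have he' : RuleTerm M P i j e := Or.inr ⟨Finset.mem_range.1 he, h0⟩
    obtain ⟨a, b, hab⟩ := hU e he'
    simp only [mul_smul, ← Finset.smul_sum, ← smul_sub]
    apply Submodule.smul_mem
    rw [← hab _ (Or.inl rfl), ← reduct_congr hab]
    apply sub_mem_relSpan h'
    rw [hab _ (Or.inl rfl)]
    exact hn e (Finset.mem_range.1 he) he'
  have h2 : ∑ e ∈ Finset.range (ruleLen M i' j'),
      ruleCoeff M P i' j' e • Finsupp.single (U (ruleLen M i j) e) 1 - S ∈ relSpan M P n := by
    rw [hS, Finset.sum_comm, ← Finset.sum_sub_distrib]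
    refine Submodule.sum_mem _ fun e he => ?_
    by_cases h0 : ruleCoeff M P i' j' e = 0
    · simp [h0]
    have he' : RuleTerm M P i' j' e := Or.inr ⟨Finset.mem_range.1 he, h0⟩
    obtain ⟨a, b, hab⟩ := hU' e he'
    simp only [mul_comm (ruleCoeff M P i j _), mul_smul, ← Finset.smul_sum, ← smul_sub]
    apply Submodule.smul_mem
    rw [← hab _ (Or.inl rfl), ← reduct_congr hab]
    apply sub_mem_relSpan h
    rw [hab _ (Or.inl rfl)]
    exact hn' e (Finset.mem_range.1 he) he'
  have := Submodule.sub_mem _ h1 h2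
  rwa [sub_sub_sub_cancel_right] at this

end Rules
-- Resolution of the individual overlaps
section Confluence

open TraceMonoid

variable {B : Type*} {M : CoxeterMatrix B} {P : TLParams}

theorem TraceMonoid.Ind.mul_left_comm {x y : TraceMonoid M} (h : Ind x y) (z : TraceMonoid M) :
    x * (y * z) = y * (x * z) := by
  rw [← mul_assoc, h.mul_comm, mul_assoc]

/-- Since `a₂` and `a₃` commute with the whole first word, that word can be moved to the left of the
second one. The two then occupy consecutive places, and replacing either by shorter terms does not
disturb the other. -/
theorem reduct_sub_reduct_of_ind_left {n : ℕ} {i j i' j' : B} (h : IsRule M i j)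
    (h' : IsRule M i' j') {a₁ a₂ a₃ r₁ r₃ b₁ b₂ b₃ : TraceMonoid M}
    (hr : alt M i j (ruleLen M i j) = r₁ * r₃) (hr' : alt M i' j' (ruleLen M i' j') = a₂ * b₂)
    (h1 : Ind a₂ (alt M i j (ruleLen M i j))) (h2 : Ind a₃ (alt M i j (ruleLen M i j)))
    (h3 : Ind a₂ b₁) (h4 : Ind a₃ b₁) (h5 : Ind a₃ b₂) (h6 : Ind r₃ b₁) (h7 : Ind r₃ b₂)
    (hn : len (a₁ * a₂ * a₃ * (r₁ * r₃) * (b₁ * b₂ * b₃)) ≤ n + 1) :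
    reduct M P (a₁ * a₂ * a₃) i j (b₁ * b₂ * b₃) - reduct M P (a₁ * r₁ * b₁) i' j' (a₃ * r₃ * b₃) ∈
      relSpan M P n := by
  have hl := congrArg len hr
  have hl' := congrArg len hr'
  simp only [len_mul, len_alt] at hl hl' hn
  set U : ℕ → ℕ → TraceMonoid M := fun e e' =>
    a₁ * alt M i j e * b₁ * alt M i' j' e' * a₃ * b₃ with hU
  have e1 : ∀ e, RuleTerm M P i j e → a₁ * a₂ * a₃ * alt M i j e * (b₁ * b₂ * b₃) =
      U e (ruleLen M i' j') := fun e he => by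
    have h1' : Ind a₂ (alt M i j e) := h1.mono (fun _ h => h) (content_alt_subset _ _ he.le)
    have h2' : Ind a₃ (alt M i j e) := h2.mono (fun _ h => h) (content_alt_subset _ _ he.le)
    simp only [hU, hr', mul_assoc, h1'.mul_left_comm, h2'.mul_left_comm, h3.mul_left_comm,
      h4.mul_left_comm, h5.mul_left_comm]
  have e2 : ∀ e, RuleTerm M P i' j' e → a₁ * r₁ * b₁ * alt M i' j' e * (a₃ * r₃ * b₃) =
      U (ruleLen M i j) e := fun e he => by
    rw [hr] at h1 h2
    have h8 : Ind r₃ (alt M i' j' e) := by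
      refine Ind.mono ?_ (fun _ h => h) (content_alt_subset _ _ he.le)
      rw [hr', ind_mul_right]
      exact ⟨(ind_mul_right.1 h1).2.symm, h7⟩
    have h9 : Ind r₃ a₃ := (ind_mul_right.1 h2).2.symm
    simp only [hU, hr, mul_assoc, h6.mul_left_comm, h8.mul_left_comm, h9.mul_left_comm]
  rw [reduct_congr e1, reduct_congr e2]
  apply sum_sub_sum_mem_relSpan h h'
  · intro e he _
    simp only [hU, len_mul, len_alt]
    omega
  · intro e he _
    simp only [hU, len_mul, len_alt]
    omega
  · intro e _
    exact ⟨a₁ * alt M i j e * b₁, a₃ * b₃, fun e' _ => by simp only [hU, mul_assoc]⟩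
  · intro e' _
    exact ⟨a₁, b₁ * alt M i' j' e' * a₃ * b₃, fun e' _ => by simp only [hU, mul_assoc]⟩

/-- The mirror case: `b₁` and `b₂` commute with the first word, which therefore moves to the right
of the second. -/
theorem reduct_sub_reduct_of_ind_right {n : ℕ} {i j i' j' : B} (h : IsRule M i j)
    (h' : IsRule M i' j') {a₁ a₂ a₃ r₁ r₃ b₁ b₂ b₃ : TraceMonoid M}
    (hr : alt M i j (ruleLen M i j) = r₁ * r₃) (hr' : alt M i' j' (ruleLen M i' j') = a₂ * b₂)
    (h1 : Ind b₂ (alt M i j (ruleLen M i j))) (h2 : Ind b₁ (alt M i j (ruleLen M i j)))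
    (h3 : Ind a₂ b₁) (h4 : Ind a₃ b₁) (h5 : Ind a₃ b₂) (h6 : Ind a₃ r₁) (h7 : Ind a₂ r₁)
    (hn : len (a₁ * a₂ * a₃ * (r₁ * r₃) * (b₁ * b₂ * b₃)) ≤ n + 1) :
    reduct M P (a₁ * a₂ * a₃) i j (b₁ * b₂ * b₃) - reduct M P (a₁ * r₁ * b₁) i' j' (a₃ * r₃ * b₃) ∈
      relSpan M P n := by
  have hl := congrArg len hr
  have hl' := congrArg len hr'
  simp only [len_mul, len_alt] at hl hl' hn
  set U : ℕ → ℕ → TraceMonoid M := fun e e' =>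
    a₁ * b₁ * alt M i' j' e' * a₃ * alt M i j e * b₃ with hU
  have e1 : ∀ e, RuleTerm M P i j e → a₁ * a₂ * a₃ * alt M i j e * (b₁ * b₂ * b₃) =
      U e (ruleLen M i' j') := fun e he => by
    have h1' : Ind (alt M i j e) b₂ := (h1.mono (fun _ h => h) (content_alt_subset _ _ he.le)).symm
    have h2' : Ind (alt M i j e) b₁ := (h2.mono (fun _ h => h) (content_alt_subset _ _ he.le)).symm
    simp only [hU, hr', mul_assoc, h1'.mul_left_comm, h2'.mul_left_comm, h3.mul_left_comm,
      h4.mul_left_comm, h5.mul_left_comm]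
  have e2 : ∀ e, RuleTerm M P i' j' e → a₁ * r₁ * b₁ * alt M i' j' e * (a₃ * r₃ * b₃) =
      U (ruleLen M i j) e := fun e he => by
    rw [hr] at h1 h2
    have h8 : Ind r₁ (alt M i' j' e) := by
      refine Ind.mono ?_ (fun _ h => h) (content_alt_subset _ _ he.le)
      rw [hr', ind_mul_right]
      exact ⟨h7.symm, (ind_mul_right.1 h1).1.symm⟩
    have h9 : Ind r₁ b₁ := (ind_mul_right.1 h2).1.symm
    simp only [hU, hr, mul_assoc, h6.symm.mul_left_comm, h8.mul_left_comm, h9.mul_left_comm]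
  rw [reduct_congr e1, reduct_congr e2]
  apply sum_sub_sum_mem_relSpan h h'
  · intro e he _
    simp only [hU, len_mul, len_alt]
    omega
  · intro e he _
    simp only [hU, len_mul, len_alt]
    omega
  · intro e _
    exact ⟨a₁ * b₁, a₃ * alt M i j e * b₃, fun e' _ => by simp only [hU, mul_assoc]⟩
  · intro e' _
    exact ⟨a₁ * b₁ * alt M i' j' e' * a₃, b₃, fun e' _ => by simp only [hU, mul_assoc]⟩

/-- Overlap in one letter, the last of the first word and the first of the second. -/
theorem reduct_sub_reduct_of_overlap_one {n s t : ℕ} {i j i' j' : B} (h : IsRule M i j)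
    (h' : IsRule M i' j') (hs : ruleLen M i j = s + 1) (ht : ruleLen M i' j' = t + 1)
    (hx : altLetter i j s = i') {a₁ a₃ b₁ b₃ : TraceMonoid M}
    (h1 : Ind a₃ (alt M i j (ruleLen M i j))) (h2 : Ind (gen M i') b₁)
    (h3 : Ind a₃ b₁) (h4 : Ind a₃ (alt M j' i' t))
    (hn : len (a₁ * a₃ * alt M i j (s + 1) * (b₁ * alt M j' i' t * b₃)) ≤ n + 1) :
    reduct M P (a₁ * a₃) i j (b₁ * alt M j' i' t * b₃) -
      reduct M P (a₁ * alt M i j s * b₁) i' j' (a₃ * b₃) ∈ relSpan M P n := by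
  simp only [len_mul, len_alt] at hn
  have h2l := h.two_le
  have h2l' := h'.two_le
  -- The shared letter `i'` stays fixed: one rule changes only what lies to its left, the other only
  -- what lies to its right.
  set U : ℕ → ℕ → TraceMonoid M := fun e e' =>
    a₁ * alt M i j (e - 1) * b₁ * gen M i' * alt M j' i' (e' - 1) * a₃ * b₃ with hU
  have last : ∀ e, RuleTerm M P i j e → alt M i j e = alt M i j (e - 1) * gen M i' := by
    intro e he
    obtain ⟨k, rfl⟩ := Nat.exists_eq_add_of_le' (he.one_le h)
    have := he.altLetter_eq 1
    rw [hs, add_assoc, add_assoc, altLetter_congr i j (n := k) (by simp [Nat.even_add]),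
      altLetter_congr i j (m := s + (1 + 1)) (n := s) (by simp [Nat.even_add]), hx] at this
    rw [alt_add, alt_one, this, Nat.add_sub_cancel]
  have first : ∀ e, RuleTerm M P i' j' e → alt M i' j' e = gen M i' * alt M j' i' (e - 1) := by
    intro e he
    obtain ⟨k, rfl⟩ := Nat.exists_eq_add_of_le' (he.one_le h')
    rfl
  have e1 : ∀ e, RuleTerm M P i j e → a₁ * a₃ * alt M i j e * (b₁ * alt M j' i' t * b₃) =
      U e (ruleLen M i' j') := fun e he => by
    have h1' : Ind a₃ (alt M i j (e - 1)) :=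
      h1.mono (fun _ h => h) (content_alt_subset _ _ ((Nat.sub_le _ _).trans he.le))
    have h5 : Ind a₃ (gen M i') := by
      rw [last _ (Or.inl rfl), ind_mul_right] at h1
      exact h1.2
    simp only [hU, last e he, mul_assoc, h1'.mul_left_comm, h2.mul_left_comm, h3.mul_left_comm,
      h4.mul_left_comm, h5.mul_left_comm, ht, Nat.add_sub_cancel]
  have e2 : ∀ e, RuleTerm M P i' j' e → a₁ * alt M i j s * b₁ * alt M i' j' e * (a₃ * b₃) =
      U (ruleLen M i j) e := fun e he => by
    simp only [hU, first e he, mul_assoc, hs, Nat.add_sub_cancel]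
  rw [reduct_congr e1, reduct_congr e2]
  apply sum_sub_sum_mem_relSpan h h'
  · intro e he _
    simp only [hU, len_mul, len_alt, len_gen]
    omega
  · intro e he _
    simp only [hU, len_mul, len_alt, len_gen]
    omega
  · intro e _
    exact ⟨a₁ * alt M i j (e - 1) * b₁, a₃ * b₃, fun e' he' => by
      simp only [hU, mul_assoc, first e' he']⟩
  · intro e' _
    exact ⟨a₁, b₁ * alt M j' i' (e' - 1) * a₃ * b₃, fun e he => by
      simp only [hU, mul_assoc, last e he, h2.mul_left_comm]⟩

/-- Overlap in the middle letter of two words of length three. -/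
theorem reduct_sub_reduct_of_overlap_middle {n : ℕ} {i j i' : B} (hij : i ≠ j) (hij' : i' ≠ j)
    (hm : ruleLen M i j = 3) (hm' : ruleLen M i' j = 3) {a₁ a₃ b₁ b₃ : TraceMonoid M}
    (h1 : Ind a₃ (gen M i)) (h2 : Ind a₃ (gen M i')) (h3 : Ind a₃ b₁) (h4 : Ind (gen M i) b₁)
    (h5 : Ind (gen M i') b₁) (h6 : Ind (gen M i') (gen M i))
    (hn : len a₁ + len a₃ + len b₁ + len b₃ + 5 ≤ n + 1) :
    reduct M P (a₁ * gen M i' * a₃) i j (b₁ * gen M i' * b₃) -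
      reduct M P (a₁ * gen M i * b₁) i' j (a₃ * gen M i * b₃) ∈ relSpan M P n := by
  -- For label 3 parity leaves only the coefficient `P.d 3 1`, which is common to the two edges.
  have key : ∀ {k : B}, k ≠ j → ruleLen M k j = 3 → ∀ a b : TraceMonoid M,
      reduct M P a k j b = P.d 3 1 • Finsupp.single (a * gen M k * b) 1 := by
    intro k hk hkm a b
    have hkM : M k j = 3 := by rwa [ruleLen_of_ne hk] at hkm
    have h2 : P.d 3 2 = 0 := by
      by_contra h
      have := P.parity _ _ h
      revert this
      decide
    simp [reduct, hkm, Finset.sum_range_succ, ruleCoeff, hk, hkM, P.d_zero, h2]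
  have key2 : ∀ (k : B) (a b : TraceMonoid M), len a + len b + 2 ≤ n →
      Finsupp.single (a * (gen M k * gen M k) * b) (1 : ℂ) -
        P.c • Finsupp.single (a * gen M k * b) 1 ∈ relSpan M P n := by
    intro k a b hab
    have := sub_mem_relSpan (P := P) (n := n) (a := a) (b := b) (isRule_self (M := M) k) (by
      rw [ruleLen_self, len_mul, len_mul, len_alt]; omega)
    rw [ruleLen_self, alt_succ, alt_one] at this
    simpa [reduct, ruleLen_self, Finset.sum_range_succ, ruleCoeff] using this
  rw [key hij hm, key hij' hm', ← smul_sub]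
  apply Submodule.smul_mem
  -- After the edge rules the words contain `i' i i'` and `i i' i`; as `i` and `i'` commute, the
  -- quadratic rule takes both to `P.c` times the word with `i i'`.
  have e1 := key2 i' (a₁ * b₁ * gen M i) (a₃ * b₃) (by simp only [len_mul, len_gen]; omega)
  have e2 := key2 i (a₁ * b₁ * gen M i') (a₃ * b₃) (by simp only [len_mul, len_gen]; omega)
  have e3 : a₁ * gen M i' * a₃ * gen M i * (b₁ * gen M i' * b₃) =
      a₁ * b₁ * gen M i * (gen M i' * gen M i') * (a₃ * b₃) := by
    simp only [mul_assoc, h1.mul_left_comm, h2.mul_left_comm, h3.mul_left_comm, h4.mul_left_comm,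
      h5.mul_left_comm, h6.mul_left_comm]
  have e4 : a₁ * gen M i * b₁ * gen M i' * (a₃ * gen M i * b₃) =
      a₁ * b₁ * gen M i' * (gen M i * gen M i) * (a₃ * b₃) := by
    simp only [mul_assoc, h1.mul_left_comm, h4.mul_left_comm, h6.symm.mul_left_comm]
  have e5 : a₁ * b₁ * gen M i * gen M i' * (a₃ * b₃) =
      a₁ * b₁ * gen M i' * gen M i * (a₃ * b₃) := by
    simp only [mul_assoc, h6.mul_left_comm]
  rw [e3, e4]
  rw [e5] at e1
  have := Submodule.sub_mem _ e1 e2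
  rwa [sub_sub_sub_cancel_right] at this

/-- Overlap of two words in the same two letters. -/
theorem reduct_eq_reduct_of_overlap {s : ℕ} {i j i' j' : B} (hi : altLetter i j s = i')
    (hj : altLetter j i s = j') {a₁ a₃ b₁ b₃ : TraceMonoid M}
    (h1 : Ind a₃ (alt M i j (ruleLen M i j))) (h2 : Ind (alt M i j (ruleLen M i j)) b₁)
    (h3 : Ind a₃ b₁) {b₂ : TraceMonoid M} (h4 : Ind a₃ b₂)
    (hb : b₂ = alt M (altLetter i j (ruleLen M i j)) (altLetter j i (ruleLen M i j)) s)
    (hr : Ind (alt M i j s) b₁) :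
    reduct M P (a₁ * a₃) i j (b₁ * b₂ * b₃) =
      reduct M P (a₁ * alt M i j s * b₁) i' j' (a₃ * b₃) := by
  -- The pair `(i', j')` is `(i, j)` or `(j, i)` according to the parity of `s`, and the rule data
  -- are symmetric.
  have hc : ruleLen M i' j' = ruleLen M i j ∧ ruleCoeff M P i' j' = ruleCoeff M P i j := by
    by_cases hs : Even s
    · simp only [altLetter, hs, if_true] at hi hj
      subst hi hj
      exact ⟨rfl, rfl⟩
    · simp only [altLetter, hs, if_false] at hi hj
      subst hi hj
      exact ⟨ruleLen_symm _ _, ruleCoeff_symm _ _⟩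
  -- The two left-hand sides together form an alternating word of length `s + ruleLen M i j`;
  -- reducing at either end turns it into the same words of length `s + e`.
  have e1 : ∀ e, RuleTerm M P i j e → a₁ * a₃ * alt M i j e * (b₁ * b₂ * b₃) =
      a₁ * b₁ * alt M i j (s + e) * a₃ * b₃ := fun e he => by
    have h1' : Ind a₃ (alt M i j e) := h1.mono (fun _ h => h) (content_alt_subset _ _ he.le)
    have h2' : Ind (alt M i j e) b₁ := h2.mono (content_alt_subset _ _ he.le) (fun _ h => h)
    have h6 : altLetter i j e = altLetter i j (ruleLen M i j) := he.altLetter_eq 0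
    have h7 : altLetter j i e = altLetter j i (ruleLen M i j) := by
      simpa only [altLetter_succ] using he.altLetter_eq 1
    have h5 : alt M i j (s + e) = alt M i j e * b₂ := by rw [add_comm, alt_add, h6, h7, hb]
    simp only [h5, mul_assoc, h1'.mul_left_comm, h2'.mul_left_comm, h3.mul_left_comm,
      h4.mul_left_comm]
  have e2 : ∀ e, RuleTerm M P i' j' e → a₁ * alt M i j s * b₁ * alt M i' j' e * (a₃ * b₃) =
      a₁ * b₁ * alt M i j (s + e) * a₃ * b₃ := fun e he => by
    rw [alt_add, hi, hj]
    simp only [mul_assoc, hr.mul_left_comm]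
  rw [reduct_congr e1, reduct_congr e2, hc.1, hc.2]

end Confluence
-- Local confluence
section Diamond

open TraceMonoid

variable {B : Type*} {M : CoxeterMatrix B} {P : TLParams}

theorem altLetter_dep_succ {i j : B} (h : M i j ≠ 2) (n : ℕ) :
    M (altLetter i j n) (altLetter i j (n + 1)) ≠ 2 := by
  by_cases hn : Even n <;> simp [altLetter, hn, Nat.even_add_one, h, M.symmetric j i]

theorem TraceMonoid.altLetter_mem_content_alt (i j : B) {n k : ℕ} (h : k < n) :
    altLetter i j k ∈ content (alt M i j n) := by
  rw [mem_content_alt]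
  rcases Nat.eq_zero_or_pos k with rfl | hk
  · exact Or.inl ⟨by omega, by simp⟩
  · rcases altLetter_eq_or i j k with h' | h' <;> rw [h']
    · exact Or.inl ⟨by omega, rfl⟩
    · exact Or.inr ⟨by omega, rfl⟩

/-- An alternating word of the length of a rule has all its letters in one of any two complementary
factors. -/
theorem IsRule.content_subset_or {i j : B} (h : IsRule M i j) {p q : ℕ}
    (hpq : ruleLen M i j = p + q) :
    (content (alt M i j (ruleLen M i j)) ⊆ content (alt M i j p)) ∨
      content (alt M i j (ruleLen M i j)) ⊆
        content (alt M (altLetter i j p) (altLetter j i p) q) := by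
  have h2 := h.two_le
  by_cases hij : i = j
  · subst hij
    simp only [altLetter_self]
    rcases Nat.eq_zero_or_pos p with hp | hp
    · refine Or.inr fun k hk => ?_
      rw [mem_content_alt] at hk ⊢
      exact Or.inl ⟨by omega, by tauto⟩
    · refine Or.inl fun k hk => ?_
      rw [mem_content_alt] at hk ⊢
      exact Or.inl ⟨by omega, by tauto⟩
  · have h3 := h.three_le hij
    rcases Nat.lt_or_ge p 2 with hp | hp
    · refine Or.inr fun k hk => ?_
      rw [mem_content_alt] at hk ⊢
      have hq : 2 ≤ q := by omega
      by_cases he : Even p <;> simp only [altLetter, he, if_true, if_false] <;>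
        rcases hk with ⟨-, rfl⟩ | ⟨-, rfl⟩ <;> simp [hq, (by omega : 1 ≤ q)]
    · refine Or.inl fun k hk => ?_
      rw [mem_content_alt] at hk ⊢
      rcases hk with ⟨-, rfl⟩ | ⟨-, rfl⟩
      · exact Or.inl ⟨by omega, rfl⟩
      · exact Or.inr ⟨by omega, rfl⟩

theorem content_alt_altLetter_subset (i j : B) (p : ℕ) {q n : ℕ} (hq : 2 ≤ q) :
    content (alt M i j n) ⊆ content (alt M (altLetter i j p) (altLetter j i p) q) := by
  intro k hk
  rw [mem_content_alt] at hk ⊢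
  by_cases he : Even p <;> simp only [altLetter, he, if_true, if_false] <;>
    rcases hk with ⟨-, rfl⟩ | ⟨-, rfl⟩ <;> simp [hq, (by omega : 1 ≤ q)]

theorem ruleLen_altLetter (i j : B) (n : ℕ) :
    ruleLen M (altLetter i j n) (altLetter j i n) = ruleLen M i j := by
  by_cases h : Even n <;> simp [altLetter, h, ruleLen_symm j i]

/-- Local confluence: two reductions of a trace agree modulo relations of smaller length. -/
theorem reduct_sub_reduct_mem {n : ℕ} {i j i' j' : B} (h : IsRule M i j) (h' : IsRule M i' j')
    {a b a' b' : TraceMonoid M}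
    (heq : a * alt M i j (ruleLen M i j) * b = a' * alt M i' j' (ruleLen M i' j') * b')
    (hn : len (a * alt M i j (ruleLen M i j) * b) ≤ n + 1) :
    reduct M P a i j b - reduct M P a' i' j' b' ∈ relSpan M P n := by
  have hn' := hn
  rw [heq] at hn'
  -- In this three by three grid `r₂` is the overlap of the two left-hand sides; the cases below are
  -- distinguished by its length `p₂`.
  obtain ⟨a₁, a₂, a₃, r₁, r₂, r₃, b₁, b₂, b₃, rfl, hr, rfl, rfl, hr', rfl, i21, i2b1, i31, i32,
    i3b1, i3b2, ir2b1, ir3b1, ir3b2⟩ := levi₃ heq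
  obtain ⟨p₁, p₂, p₃, hp, hr1, hr2, hr3⟩ := alt_eq_mul_mul h.1 hr
  obtain ⟨q₁, q₂, q₃, hq, ha2, hr2', hb2⟩ := alt_eq_mul_mul h'.1 hr'
  have h2l := h.two_le
  have h2l' := h'.two_le
  have hdep : ∀ k, M (altLetter i j k) (altLetter i j (k + 1)) ≠ 2 := altLetter_dep_succ h.1
  have hdep' : ∀ k, M (altLetter i' j' k) (altLetter i' j' (k + 1)) ≠ 2 := altLetter_dep_succ h'.1
  have hd2 : M (altLetter i j p₁) (altLetter j i p₁) ≠ 2 := by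
    have := hdep p₁
    rwa [altLetter_succ] at this
  obtain ⟨rfl, hl1, hl2⟩ := alt_inj hd2 (hr2.symm.trans hr2')
  have hl1 : 1 ≤ p₂ → altLetter i j p₁ = altLetter i' j' q₁ := hl1
  have add_two : ∀ (k l : B) (c : ℕ), altLetter k l (c + 2) = altLetter k l c := fun k l c => by
    rw [altLetter_succ, altLetter_succ]
  have mem_r₁ : ∀ k < p₁, altLetter i j k ∈ content r₁ := fun k hk => by
    rw [hr1]; exact altLetter_mem_content_alt i j hk
  have mem_a₂ : ∀ k < q₁, altLetter i' j' k ∈ content a₂ := fun k hk => by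
    rw [ha2]; exact altLetter_mem_content_alt i' j' hk
  have mem_r₃ : ∀ k < p₃, altLetter i j (p₁ + p₂ + k) ∈ content r₃ := fun k hk => by
    rw [hr3, ← altLetter_altLetter i j (p₁ + p₂)]; exact altLetter_mem_content_alt _ _ hk
  have mem_b₂ : ∀ k < q₃, altLetter i' j' (q₁ + p₂ + k) ∈ content b₂ := fun k hk => by
    rw [hb2, ← altLetter_altLetter i' j' (q₁ + p₂)]; exact altLetter_mem_content_alt _ _ hk
  obtain h0 | h0 | h0 : p₂ = 0 ∨ p₂ = 1 ∨ 2 ≤ p₂ := by omega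
  · -- disjoint words
    subst h0
    obtain rfl : r₂ = 1 := hr2
    rw [mul_one] at hr hr'
    rw [hr] at hn
    rcases h.content_subset_or (p := p₁) (q := p₃) (by omega) with hs | hs
    · rw [← hr1] at hs
      exact reduct_sub_reduct_of_ind_left h h' hr hr' (i21.mono (fun _ h => h) hs)
        (i31.mono (fun _ h => h) hs) i2b1 i3b1 i3b2 ir3b1 ir3b2 hn
    · rw [add_zero] at hr3
      rw [← hr3] at hs
      exact reduct_sub_reduct_of_ind_right h h' hr hr' (ir3b2.symm.mono (fun _ h => h) hs)
        (ir3b1.symm.mono (fun _ h => h) hs) i2b1 i3b1 i3b2 i31 i21 hn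
  · -- overlap in one letter
    subst h0
    obtain ⟨x, hx⟩ : ∃ x, x = altLetter i j p₁ := ⟨_, rfl⟩
    have hx' : x = altLetter i' j' q₁ := hx.trans (hl1 le_rfl)
    have hr2 : r₂ = gen M x := by rw [hr2, alt_one, hx]
    -- If `a₂` were nonempty, its last letter, which precedes `x` in the second word, would be
    -- dependent on `x`, although `a₂` commutes with `r₁`. The next three statements are the
    -- analogues for the other corners.
    have n1 : x ∈ content r₁ → q₁ = 0 := fun hxr => by
      by_contra hq₁
      obtain ⟨k, rfl⟩ := Nat.exists_eq_succ_of_ne_zero hq₁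
      exact hdep' k (hx' ▸ i21 _ (mem_a₂ k (by omega)) _ hxr)
    have n2 : x ∈ content a₂ → p₁ = 0 := fun hxa => by
      by_contra hp₁
      obtain ⟨k, rfl⟩ := Nat.exists_eq_succ_of_ne_zero hp₁
      exact hdep k (hx ▸ i21.symm _ (mem_r₁ k (by omega)) _ hxa)
    have n3 : x ∈ content r₃ → q₃ = 0 := fun hxr => by
      by_contra hq₃
      exact hdep' q₁ (hx' ▸ ir3b2 _ hxr _ (mem_b₂ 0 (by omega)))
    have n4 : x ∈ content b₂ → p₃ = 0 := fun hxb => by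
      by_contra hp₃
      exact hdep p₁ (hx ▸ ir3b2.symm _ hxb _ (mem_r₃ 0 (by omega)))
    -- Two places before the shared letter the alternating word has `x` again.
    have two1 : 2 ≤ p₁ → q₁ = 0 := fun hp₁ => by
      obtain ⟨k, rfl⟩ := Nat.exists_eq_add_of_le' hp₁
      apply n1
      rw [hx, add_two]
      exact mem_r₁ k (by omega)
    have two2 : 2 ≤ q₁ → p₁ = 0 := fun hp₁ => by
      obtain ⟨k, rfl⟩ := Nat.exists_eq_add_of_le' hp₁
      apply n2
      rw [hx', add_two]
      exact mem_a₂ k (by omega)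
    have two3 : 2 ≤ p₃ → q₃ = 0 := fun hp₃ => by
      apply n3
      rw [hx, ← add_two]
      exact mem_r₃ 1 (by omega)
    have two4 : 2 ≤ q₃ → p₃ = 0 := fun hp₃ => by
      apply n4
      rw [hx', ← add_two]
      exact mem_b₂ 1 (by omega)
    by_cases hmid : (1 ≤ p₁ ∧ 1 ≤ q₁) ∨ (1 ≤ p₃ ∧ 1 ≤ q₃)
    · have hij : i ≠ j := by
        rintro rfl
        rw [altLetter_self] at hx
        subst hx
        rcases hmid with hm | hm
        · have := n1 (by simpa using mem_r₁ 0 (by omega))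
          omega
        · have := n3 (by simpa using mem_r₃ 0 (by omega))
          omega
      have hij' : i' ≠ j' := by
        rintro rfl
        rw [altLetter_self] at hx'
        subst hx'
        rcases hmid with hm | hm
        · have := n2 (by simpa using mem_a₂ 0 (by omega))
          omega
        · have := n4 (by simpa using mem_b₂ 0 (by omega))
          omega
      have h3 := h.three_le hij
      have h3' := h'.three_le hij'
      -- On a side where both words continue, neither continues by two letters; as both words have
      -- length at least 3, they also continue on the other side, by one letter each.
      obtain ⟨rfl, rfl, rfl, rfl⟩ : p₁ = 1 ∧ q₁ = 1 ∧ p₃ = 1 ∧ q₃ = 1 := by omega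
      have hj : ∀ k l : B, altLetter k l 1 = l := fun k l => by simp [altLetter]
      have hk : ∀ k l : B, altLetter k l (1 + 1) = k := fun k l => by simp [altLetter]
      rw [hj] at hx hx'
      subst hx
      subst hx'
      rw [alt_one] at hr1 ha2 hr3 hb2
      rw [hk] at hr3 hb2
      subst hr1 ha2 hr3 hb2 hr2
      apply reduct_sub_reduct_of_overlap_middle hij hij' hp hq i31 i3b2 i3b1 ir3b1 i2b1 i21
      simp only [len_mul, len_alt, len_gen] at hn
      omega
    · have hcase : (q₁ = 0 ∧ p₃ = 0) ∨ (p₁ = 0 ∧ q₃ = 0) := by omega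
      rcases hcase with ⟨rfl, rfl⟩ | ⟨rfl, rfl⟩
      · obtain rfl : a₂ = 1 := ha2
        obtain rfl : r₃ = 1 := hr3
        simp only [mul_one, one_mul, altLetter_zero, zero_add] at *
        subst hx'
        rw [altLetter_succ, altLetter_succ, altLetter_zero, altLetter_zero] at hb2
        subst hr1 hr2 hb2
        refine reduct_sub_reduct_of_overlap_one h h' hp (by omega) hx.symm ?_ ir2b1 i3b1 i3b2
          (by rwa [hp] at hn)
        rw [hr, ind_mul_right]
        exact ⟨i31, i32⟩
      · obtain rfl : r₁ = 1 := hr1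
        obtain rfl : b₂ = 1 := hb2
        simp only [mul_one, one_mul, altLetter_zero, zero_add] at *
        subst hx
        rw [altLetter_succ, altLetter_succ, altLetter_zero, altLetter_zero] at hr3
        subst ha2 hr2 hr3
        rw [← neg_sub]
        refine Submodule.neg_mem _ (reduct_sub_reduct_of_overlap_one h' h hq (by omega) hx'.symm ?_
          i32.symm i3b1.symm ir3b1.symm (by rwa [hq] at hn'))
        rw [hr', ind_mul_right]
        exact ⟨i2b1.symm, ir2b1.symm⟩
  · -- overlap in at least two letters
    have hi := hl1 (by omega)
    have hj := hl2 h0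
    have hs : content (alt M i j (ruleLen M i j)) ⊆ content r₂ := by
      rw [hr2]; exact content_alt_altLetter_subset i j p₁ h0
    have hs' : content (alt M i' j' (ruleLen M i' j')) ⊆ content r₂ := by
      rw [hr2']; exact content_alt_altLetter_subset i' j' q₁ h0
    have hm : ruleLen M i j = ruleLen M i' j' := by
      rw [← ruleLen_altLetter i j p₁, ← ruleLen_altLetter i' j' q₁, hi, hj]
    -- Otherwise the letters just before the overlap would be one and the same letter, lying in the
    -- independent traces `a₂` and `r₁`; but a letter is dependent on itself.
    have c1 : p₁ = 0 ∨ q₁ = 0 := by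
      by_contra! hc
      obtain ⟨k, rfl⟩ := Nat.exists_eq_succ_of_ne_zero hc.1
      obtain ⟨l, rfl⟩ := Nat.exists_eq_succ_of_ne_zero hc.2
      have := i21 _ (mem_a₂ l (by omega)) _ (mem_r₁ k (by omega))
      rw [altLetter_succ, altLetter_succ] at hj
      rw [hj] at this
      simp at this
    have c2 : p₃ = 0 ∨ q₃ = 0 := by
      by_contra! hc
      have := ir3b2 _ (mem_r₃ 0 (by omega)) _ (mem_b₂ 0 (by omega))
      rw [add_zero, add_zero, ← altLetter_altLetter, ← altLetter_altLetter i', hi, hj] at this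
      simp at this
    have hcase : (q₁ = 0 ∧ p₃ = 0 ∧ q₃ = p₁) ∨ (p₁ = 0 ∧ q₃ = 0 ∧ p₃ = q₁) := by omega
    have a3r := i32.mono (fun _ h => h) hs
    have b1r := ir2b1.mono hs (fun _ h => h)
    have a3r' := i32.mono (fun _ h => h) hs'
    have b1r' := ir2b1.mono hs' (fun _ h => h)
    rcases hcase with ⟨rfl, rfl, rfl⟩ | ⟨rfl, rfl, rfl⟩
    · obtain rfl : a₂ = 1 := ha2
      obtain rfl : r₃ = 1 := hr3
      simp only [mul_one, one_mul, altLetter_zero, zero_add, add_zero] at *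
      rw [← hi, ← hj, altLetter_altLetter, altLetter_altLetter, ← hp] at hb2
      have hr1b1 : Ind r₁ b₁ := by
        rw [hr, ind_mul_left] at b1r
        exact b1r.1
      rw [hr1] at hr1b1 ⊢
      rw [reduct_eq_reduct_of_overlap hi hj a3r b1r i3b1 i3b2 hb2 hr1b1, sub_self]
      exact Submodule.zero_mem _
    · obtain rfl : r₁ = 1 := hr1
      obtain rfl : b₂ = 1 := hb2
      simp only [mul_one, one_mul, altLetter_zero, zero_add, add_zero] at *
      rw [hi, hj, altLetter_altLetter, altLetter_altLetter, ← hq] at hr3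
      have ha2a3 : Ind a₂ a₃ := by
        rw [hr', ind_mul_right] at a3r'
        exact a3r'.1.symm
      rw [ha2] at ha2a3 ⊢
      rw [reduct_eq_reduct_of_overlap hi.symm hj.symm b1r'.symm a3r'.symm i3b1.symm ir3b1.symm hr3
        ha2a3, sub_self]
      exact Submodule.zero_mem _

end Diamond
-- Normal forms and the module of traces modulo the rules
section NormalForms

open TraceMonoid

variable {B : Type*} (M : CoxeterMatrix B) (P : TLParams)

variable {M} in
/-- A trace is normal when none of its factors is the left-hand side of a reduction. -/
def IsNormal (t : TraceMonoid M) : Prop :=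
  ∀ a b i j, IsRule M i j → t ≠ a * alt M i j (ruleLen M i j) * b

/-- The span of the differences of the two sides of all reductions in all contexts. -/
noncomputable def relIdeal : Submodule ℂ (TraceMonoid M →₀ ℂ) := ⨆ n, relSpan M P n

variable {M P}

theorem mem_relIdeal {x : TraceMonoid M →₀ ℂ} : x ∈ relIdeal M P ↔ ∃ n, x ∈ relSpan M P n :=
  Submodule.mem_iSup_of_directed _ (directed_of_isDirected_le fun _ _ h => relSpan_mono h)

theorem len_lt_of_lt_ruleLen {i j : B} {e : ℕ} (he : e < ruleLen M i j) (a b : TraceMonoid M) :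
    len (a * alt M i j e * b) < len (a * alt M i j (ruleLen M i j) * b) := by
  simp only [len_mul, len_alt]
  omega

/-- The diamond lemma by induction on length. A reducible trace of length `n + 1` is sent to the
normalization of any of its reducts; local confluence makes the choice immaterial, since reducts
differ by an element of `relSpan M P n`, which the previous map kills. A combination of normal
traces lying in the relations is thus both fixed and killed. -/
theorem exists_normalization (n : ℕ) :
    ∃ f : (TraceMonoid M →₀ ℂ) →ₗ[ℂ] (TraceMonoid M →₀ ℂ),
      (∀ t, IsNormal t → f (Finsupp.single t 1) = Finsupp.single t 1) ∧
        relSpan M P n ≤ LinearMap.ker f := by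
  classical
  induction n with
  | zero =>
    refine ⟨LinearMap.id, fun t _ => rfl, ?_⟩
    rw [relSpan, Submodule.span_le]
    rintro x ⟨a, b, i, j, h, hn, -⟩
    have := h.two_le
    simp only [len_mul, len_alt] at hn
    omega
  | succ n ih =>
    obtain ⟨f, hf, hk⟩ := ih
    have choice : ∀ t : TraceMonoid M, ∃ y, (len t ≠ n + 1 ∨ IsNormal t → y = f (.single t 1)) ∧
        ∀ a b i j, IsRule M i j → t = a * alt M i j (ruleLen M i j) * b → len t = n + 1 →
          y = f (reduct M P a i j b) := by
      intro t
      by_cases ht : len t ≠ n + 1 ∨ IsNormal t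
      · refine ⟨_, fun _ => rfl, fun a b i j h h' h'' => ?_⟩
        rcases ht with ht | ht
        · exact absurd h'' ht
        · exact absurd h' (ht a b i j h)
      · obtain ⟨h1, h2⟩ := not_or.1 ht
        simp only [IsNormal, not_forall, not_not] at h1 h2
        obtain ⟨a, b, i, j, h, h'⟩ := h2
        refine ⟨f (reduct M P a i j b), fun h => absurd h ht, fun a' b' i' j' hr h'' hl => ?_⟩
        have := hk (reduct_sub_reduct_mem (P := P) h hr (h'.symm.trans h'') (h' ▸ hl.le))
        rw [LinearMap.mem_ker, map_sub, sub_eq_zero] at this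
        exact this
    choose g hg hg' using choice
    have hfg : ∀ t, len t ≠ n + 1 ∨ IsNormal t →
        Finsupp.linearCombination ℂ g (.single t 1) = f (.single t 1) := fun t ht => by
      rw [Finsupp.linearCombination_single, one_smul, hg t ht]
    refine ⟨Finsupp.linearCombination ℂ g, fun t ht => by rw [hfg t (Or.inr ht), hf t ht], ?_⟩
    rw [relSpan, Submodule.span_le]
    rintro x ⟨a, b, i, j, h, hn, rfl⟩
    -- The terms of the reduct have length at most `n`, where the new map agrees with `f`.
    have hred : Finsupp.linearCombination ℂ g (reduct M P a i j b) = f (reduct M P a i j b) := by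
      simp only [reduct, map_sum, map_smul]
      refine Finset.sum_congr rfl fun e he => ?_
      have := len_lt_of_lt_ruleLen (Finset.mem_range.1 he) a b
      rw [hfg _ (Or.inl (by omega))]
    rw [SetLike.mem_coe, LinearMap.mem_ker, map_sub, hred, sub_eq_zero]
    by_cases hl : len (a * alt M i j (ruleLen M i j) * b) = n + 1
    · rw [Finsupp.linearCombination_single, one_smul, hg' _ a b i j h rfl hl]
    · rw [hfg _ (Or.inl hl), ← sub_eq_zero, ← map_sub]
      exact hk (sub_mem_relSpan h (by omega))

/-- Left multiplication by a letter on the free module over the traces. -/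
noncomputable def mulLetter (M : CoxeterMatrix B) (i : B) :
    (TraceMonoid M →₀ ℂ) →ₗ[ℂ] (TraceMonoid M →₀ ℂ) := Finsupp.lmapDomain ℂ ℂ (gen M i * ·)

theorem mulLetter_single (i : B) (t : TraceMonoid M) (z : ℂ) :
    mulLetter M i (.single t z) = .single (gen M i * t) z := by simp [mulLetter]

theorem mulLetter_reduct (k i j : B) (a b : TraceMonoid M) :
    mulLetter M k (reduct M P a i j b) = reduct M P (gen M k * a) i j b := by
  simp only [reduct, map_sum, map_smul, mulLetter_single, mul_assoc]

/-- A letter prefixed to the context raises the length bound by one, so only the union over all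
lengths is stable. -/
theorem relIdeal_le_comap (k : B) : relIdeal M P ≤ (relIdeal M P).comap (mulLetter M k) := by
  intro x hx
  obtain ⟨n, hn⟩ := mem_relIdeal.1 hx
  rw [Submodule.mem_comap]
  refine mem_relIdeal.2 ⟨n + 1, ?_⟩
  suffices relSpan M P n ≤ (relSpan M P (n + 1)).comap (mulLetter M k) from this hn
  conv_lhs => rw [relSpan]
  rw [Submodule.span_le]
  rintro x ⟨a, b, i, j, h, hl, rfl⟩
  rw [SetLike.mem_coe, Submodule.mem_comap, map_sub, mulLetter_single, mulLetter_reduct]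
  rw [← mul_assoc, ← mul_assoc]
  apply sub_mem_relSpan h
  simp only [len_mul, len_gen] at hl ⊢
  omega

/-- A family of elements of an algebra that satisfies the relations with parameters `P`. -/
structure IsTLFamily {A : Type*} [Ring A] [Algebra ℂ A] (M : CoxeterMatrix B) (P : TLParams)
    (x : B → A) : Prop where
  quadratic : ∀ i, x i * x i = P.c • x i
  comm : ∀ i j, M i j = 2 → x i * x j = x j * x i
  edge : ∀ i j, i ≠ j → IsRule M i j → altProd (x i) (x j) (M i j) =
    ∑ e ∈ Finset.range (M i j), P.d (M i j) e • altProd (x i) (x j) e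

/-- The action of a letter on the free module over the traces modulo all reductions. -/
noncomputable def letterAction (M : CoxeterMatrix B) (P : TLParams) (i : B) :
    Module.End ℂ ((TraceMonoid M →₀ ℂ) ⧸ relIdeal M P) :=
  (relIdeal M P).mapQ (relIdeal M P) (mulLetter M i) (relIdeal_le_comap i)

theorem letterAction_mk (i : B) (t : TraceMonoid M) :
    letterAction M P i ((relIdeal M P).mkQ (.single t 1)) =
      (relIdeal M P).mkQ (.single (gen M i * t) 1) := by
  simp [letterAction, mulLetter_single]

theorem altProd_letterAction_mk (i j : B) (n : ℕ) (t : TraceMonoid M) :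
    altProd (letterAction M P i) (letterAction M P j) n ((relIdeal M P).mkQ (.single t 1)) =
      (relIdeal M P).mkQ (.single (alt M i j n * t) 1) := by
  induction n generalizing i j with
  | zero => simp [altProd]
  | succ n ih => rw [altProd, Module.End.mul_apply, ih, letterAction_mk, alt_succ, mul_assoc]

theorem end_quotient_ext {f g : Module.End ℂ ((TraceMonoid M →₀ ℂ) ⧸ relIdeal M P)}
    (h : ∀ t, f ((relIdeal M P).mkQ (.single t 1)) = g ((relIdeal M P).mkQ (.single t 1))) :
    f = g := by
  apply Submodule.linearMap_qext
  apply Finsupp.lhom_ext'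
  intro t
  apply LinearMap.ext_ring
  exact h t

theorem mkQ_single_eq_mkQ_reduct {i j : B} (h : IsRule M i j) (t : TraceMonoid M) :
    (relIdeal M P).mkQ (.single (alt M i j (ruleLen M i j) * t) 1) =
      ∑ e ∈ Finset.range (ruleLen M i j), ruleCoeff M P i j e •
        (relIdeal M P).mkQ (.single (alt M i j e * t) 1) := by
  have : Finsupp.single (1 * alt M i j (ruleLen M i j) * t) 1 - reduct M P 1 i j t ∈
      relIdeal M P := mem_relIdeal.2 ⟨_, sub_mem_relSpan h le_rfl⟩
  rw [← Submodule.Quotient.mk_eq_zero, ← Submodule.mkQ_apply, map_sub, sub_eq_zero] at this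
  simpa only [one_mul, reduct, map_sum, map_smul] using this

/-- This turns the quotient of the trace module into a representation of the presented algebras, in
which linear independence can be tested. -/
theorem isTLFamily_letterAction : IsTLFamily M P (letterAction M P) where
  quadratic i := by
    refine end_quotient_ext fun t => ?_
    have := mkQ_single_eq_mkQ_reduct (P := P) (isRule_self (M := M) i) t
    rw [ruleLen_self] at this
    simp only [alt_succ, alt_zero, mul_one, mul_assoc, Finset.sum_range_succ, Finset.range_zero,
      Finset.sum_empty, ruleCoeff] at this
    rw [Module.End.mul_apply, letterAction_mk, letterAction_mk, this, LinearMap.smul_apply,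
      letterAction_mk]
    simp
  comm i j h := by
    refine end_quotient_ext fun t => ?_
    simp only [Module.End.mul_apply, letterAction_mk, ← mul_assoc, gen_mul_gen h]
  edge i j hij h := by
    refine end_quotient_ext fun t => ?_
    have := mkQ_single_eq_mkQ_reduct (P := P) h t
    simp only [ruleLen_of_ne hij, ruleCoeff, hij, if_false] at this
    rw [altProd_letterAction_mk, this, LinearMap.sum_apply]
    simp only [LinearMap.smul_apply, altProd_letterAction_mk]

end NormalForms

/-! ### The basis of normal traces -/

section Basis

open TraceMonoid

variable {B : Type*} {M : CoxeterMatrix B} {P : TLParams} {A : Type*} [Ring A] [Algebra ℂ A]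
  {x : B → A}

/-- The evaluation of traces at a family that satisfies the relations. -/
def IsTLFamily.eval (hx : IsTLFamily M P x) : TraceMonoid M →* A :=
  PresentedMonoid.lift x (by
    rintro a b ⟨i, j, h, rfl, rfl⟩
    simpa using hx.comm i j h)

theorem IsTLFamily.eval_gen (hx : IsTLFamily M P x) (i : B) : hx.eval (gen M i) = x i := rfl

theorem IsTLFamily.eval_alt (hx : IsTLFamily M P x) (i j : B) (n : ℕ) :
    hx.eval (alt M i j n) = altProd (x i) (x j) n := map_altProd hx.eval _ _ n

theorem IsTLFamily.eval_rule (hx : IsTLFamily M P x) {i j : B} (h : IsRule M i j)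
    (a b : TraceMonoid M) : hx.eval (a * alt M i j (ruleLen M i j) * b) =
      ∑ e ∈ Finset.range (ruleLen M i j), ruleCoeff M P i j e • hx.eval (a * alt M i j e * b) := by
  have : hx.eval (alt M i j (ruleLen M i j)) =
      ∑ e ∈ Finset.range (ruleLen M i j), ruleCoeff M P i j e • hx.eval (alt M i j e) := by
    simp only [eval_alt]
    by_cases hij : i = j
    · subst hij
      rw [ruleLen_self]
      simp [altProd, ruleCoeff, hx.quadratic]
    · simp only [ruleLen_of_ne hij, hx.edge i j hij h, ruleCoeff, hij, if_false]
  simp only [map_mul, this, Finset.mul_sum, Finset.sum_mul, mul_smul_comm, smul_mul_assoc]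

/-- Each rewriting step shortens the trace, so the process ends and never leaves the given length
bound. -/
theorem IsTLFamily.eval_mem_span_normal (hx : IsTLFamily M P x) (n : ℕ) (t : TraceMonoid M)
    (ht : len t ≤ n) :
    hx.eval t ∈ Submodule.span ℂ (hx.eval '' {t | IsNormal t ∧ len t ≤ n}) := by
  induction hl : len t using Nat.strong_induction_on generalizing t with
  | _ l ih =>
    by_cases hN : IsNormal t
    · exact Submodule.subset_span ⟨t, ⟨hN, ht⟩, rfl⟩
    · simp only [IsNormal, not_forall, not_not] at hN
      obtain ⟨a, b, i, j, h, rfl⟩ := hN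
      rw [hx.eval_rule h]
      refine Submodule.sum_mem _ fun e he => Submodule.smul_mem _ _ ?_
      have := len_lt_of_lt_ruleLen (Finset.mem_range.1 he) a b
      exact ih _ (hl ▸ this) _ (by omega) rfl

/-- With `1` among the generators, the `n`-th power contains the values of all traces of length at
most `n`. This ties the growth filtration to the length of normal traces. -/
theorem IsTLFamily.span_pow (hx : IsTLFamily M P x) (n : ℕ) :
    Submodule.span ℂ ({1} ∪ Set.range x) ^ n =
      Submodule.span ℂ (hx.eval '' {t | IsNormal t ∧ len t ≤ n}) := by
  have h1 : Submodule.span ℂ ({1} ∪ Set.range x) ^ n =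
      Submodule.span ℂ (hx.eval '' {t | len t ≤ n}) := by
    induction n with
    | zero =>
      have : {t : TraceMonoid M | len t ≤ 0} = {1} := by
        ext t
        induction t using TraceMonoid.induction with
        | one => simp
        | mul i t _ =>
          have h : gen M i * t ≠ 1 := fun h => by simpa using congrArg len h
          simp [h]
      rw [this, pow_zero, Set.image_singleton, map_one, Submodule.one_eq_span]
    | succ n ih =>
      rw [pow_succ', ih, Submodule.span_mul_span]
      congr 1
      ext y
      simp only [Set.mem_mul, Set.mem_union, Set.mem_singleton_iff, Set.mem_range, Set.mem_image,
        Set.mem_ofPred_eq]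
      constructor
      · rintro ⟨y, rfl | ⟨i, rfl⟩, -, ⟨t, ht, rfl⟩, rfl⟩
        · exact ⟨t, by omega, by simp⟩
        · exact ⟨gen M i * t, by simp only [len_mul, len_gen]; omega, by rw [map_mul, hx.eval_gen]⟩
      · rintro ⟨t, ht, rfl⟩
        induction t using TraceMonoid.induction with
        | one => exact ⟨1, Or.inl rfl, 1, ⟨1, by simp, by simp⟩, by simp⟩
        | mul i t _ =>
          rw [len_mul, len_gen] at ht
          exact ⟨x i, Or.inr ⟨i, rfl⟩, _, ⟨t, by omega, rfl⟩, by rw [map_mul, hx.eval_gen]⟩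
  rw [h1]
  apply le_antisymm
  · rw [Submodule.span_le]
    rintro _ ⟨t, ht, rfl⟩
    exact hx.eval_mem_span_normal n t ht
  · exact Submodule.span_mono (Set.image_mono fun t ht => ht.2)

/-- The traces that are normal are a basis of the algebra presented by the relations. -/
theorem IsTLFamily.exists_basis (hx : IsTLFamily M P x)
    (hgen : Algebra.adjoin ℂ (Set.range x) = ⊤)
    (ρ : A →ₐ[ℂ] Module.End ℂ ((TraceMonoid M →₀ ℂ) ⧸ relIdeal M P))
    (hρ : ∀ i, ρ (x i) = letterAction M P i) :
    ∃ b : Module.Basis {t : TraceMonoid M // IsNormal t} ℂ A,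
      ∀ n, Submodule.span ℂ ({1} ∪ Set.range x) ^ n = Submodule.span ℂ (b '' {t | len t.1 ≤ n}) := by
  -- Acting on the class of the empty trace recovers each trace modulo the relations, so a linear
  -- relation in `A` becomes an element of `relIdeal M P`.
  have hρt : ∀ t, ρ (hx.eval t) ((relIdeal M P).mkQ (.single 1 1)) =
      (relIdeal M P).mkQ (.single t 1) := fun t => by
    induction t using TraceMonoid.induction with
    | one => simp
    | mul i t ih =>
      rw [map_mul, hx.eval_gen, map_mul, hρ, Module.End.mul_apply, ih, letterAction_mk]
  have hρl : ∀ l : TraceMonoid M →₀ ℂ, ρ (Finsupp.linearCombination ℂ hx.eval l)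
      ((relIdeal M P).mkQ (.single 1 1)) = (relIdeal M P).mkQ l := fun l => by
    induction l using Finsupp.induction_linear with
    | zero => simp
    | add f g hf hg => rw [map_add, map_add, LinearMap.add_apply, hf, hg, map_add]
    | single t z =>
      rw [Finsupp.linearCombination_single, map_smul, LinearMap.smul_apply, hρt, ← map_smul,
        Finsupp.smul_single_one]
  have hli : LinearIndependent ℂ fun t : {t : TraceMonoid M // IsNormal t} => hx.eval t.1 := by
    have : LinearIndepOn ℂ hx.eval {t | IsNormal t} := by
      rw [linearIndepOn_iff]
      intro l hl h0
      have h1 : (relIdeal M P).mkQ l = 0 := by rw [← hρl, h0, map_zero, LinearMap.zero_apply]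
      rw [Submodule.mkQ_apply, Submodule.Quotient.mk_eq_zero] at h1
      obtain ⟨n, hn⟩ := mem_relIdeal.1 h1
      obtain ⟨f, hf, hk⟩ := exists_normalization (M := M) (P := P) n
      have h2 : f l = l := by
        conv_lhs => rw [← Finsupp.sum_single l]
        conv_rhs => rw [← Finsupp.sum_single l]
        rw [Finsupp.sum, map_sum]
        refine Finset.sum_congr rfl fun t ht => ?_
        rw [← Finsupp.smul_single_one, map_smul, hf t (hl ht)]
      rw [← h2]
      exact hk hn
    exact this
  have hspan : ⊤ ≤ Submodule.span ℂ
      (Set.range fun t : {t : TraceMonoid M // IsNormal t} => hx.eval t.1) := by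
    have h1 : Submonoid.closure (Set.range x) ≤ MonoidHom.mrange hx.eval := by
      rw [Submonoid.closure_le]
      rintro _ ⟨i, rfl⟩
      exact ⟨gen M i, rfl⟩
    rw [← Algebra.top_toSubmodule, ← hgen, Algebra.adjoin_eq_span, Submodule.span_le]
    intro y hy
    obtain ⟨t, rfl⟩ := h1 hy
    refine Submodule.span_mono ?_ (hx.eval_mem_span_normal _ t le_rfl)
    rintro _ ⟨s, hs, rfl⟩
    exact ⟨⟨s, hs.1⟩, rfl⟩
  refine ⟨Module.Basis.mk hli hspan, fun n => ?_⟩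
  rw [hx.span_pow n]
  congr 1
  ext y
  simp only [Set.mem_image, Set.mem_ofPred_eq, Module.Basis.mk_apply, Subtype.exists,
    exists_and_left, exists_prop]
  constructor
  · rintro ⟨t, ⟨h1, h2⟩, h3⟩
    exact ⟨t, h2, h1, h3⟩
  · rintro ⟨t, h2, h1, h3⟩
    exact ⟨t, ⟨h1, h2⟩, h3⟩

end Basis
-- Growth functions and filtrations
section Growth

variable {A : Type*} [Ring A] [Algebra ℂ A]

/-- The space `V + V ^ 2 + ⋯ + V ^ n`. -/
abbrev powSum (V : Submodule ℂ A) (n : ℕ) : Submodule ℂ A := ⨆ k ∈ Finset.Icc 1 n, V ^ k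

theorem pow_le_powSum (V : Submodule ℂ A) {k n : ℕ} (h1 : 1 ≤ k) (h2 : k ≤ n) :
    V ^ k ≤ powSum V n := le_biSup (fun k => V ^ k) (Finset.mem_Icc.2 ⟨h1, h2⟩)

theorem powSum_mono (V : Submodule ℂ A) {m n : ℕ} (h : m ≤ n) : powSum V m ≤ powSum V n :=
  iSup₂_le fun k hk => by
    rw [Finset.mem_Icc] at hk
    exact pow_le_powSum V hk.1 (hk.2.trans h)

theorem pow_le_pow_of_one_le {U : Submodule ℂ A} (hU : 1 ≤ U) {m n : ℕ} (h : m ≤ n) :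
    U ^ m ≤ U ^ n := by
  induction n, h using Nat.le_induction with
  | base => exact le_rfl
  | succ n _ ih =>
    calc U ^ m ≤ U ^ n := ih
      _ = U ^ n * 1 := (mul_one _).symm
      _ ≤ U ^ n * U := mul_le_mul' le_rfl hU
      _ = U ^ (n + 1) := (pow_succ _ _).symm

theorem powSum_le_pow {U V : Submodule ℂ A} (hU : 1 ≤ U) (hV : V ≤ U) (n : ℕ) :
    powSum V n ≤ U ^ n :=
  iSup₂_le fun k hk => (pow_le_pow_left' hV k).trans
    (pow_le_pow_of_one_le hU (Finset.mem_Icc.1 hk).2)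

theorem mul_powSum_le (V : Submodule ℂ A) (n : ℕ) : V * powSum V n ≤ powSum V (n + 1) := by
  simp only [powSum, Submodule.mul_iSup]
  refine iSup₂_le fun k hk => ?_
  rw [Finset.mem_Icc] at hk
  rw [← pow_succ']
  exact pow_le_powSum V (by omega) (by omega)

theorem one_sup_pow_le (V : Submodule ℂ A) (n : ℕ) : (1 ⊔ V) ^ n ≤ 1 ⊔ powSum V n := by
  induction n with
  | zero => simp
  | succ n ih =>
    rw [pow_succ']
    refine (mul_le_mul' le_rfl ih).trans ?_
    rw [Submodule.sup_mul, one_mul, Submodule.mul_sup, mul_one]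
    refine sup_le (sup_le_sup_left (powSum_mono V (by omega)) _) (sup_le ?_ ?_)
    · exact le_sup_of_le_right (by simpa using pow_le_powSum V le_rfl (by omega : 1 ≤ n + 1))
    · exact le_sup_of_le_right (mul_powSum_le V n)

theorem exists_mem_one_sup_pow {V : Submodule ℂ A} (hV : Algebra.adjoin ℂ (V : Set A) = ⊤) (y : A) :
    ∃ n, y ∈ (1 ⊔ V) ^ n := by
  have hy : y ∈ Algebra.adjoin ℂ (V : Set A) := hV ▸ Algebra.mem_top
  induction hy using Algebra.adjoin_induction with
  | mem y hy => exact ⟨1, by rw [pow_one]; exact Submodule.mem_sup_right hy⟩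
  | algebraMap r => exact ⟨0, by rw [pow_zero]; exact Submodule.algebraMap_mem r⟩
  | add y z _ _ hy hz =>
    obtain ⟨m, hm⟩ := hy
    obtain ⟨n, hn⟩ := hz
    exact ⟨max m n, Submodule.add_mem _ (pow_le_pow_of_one_le le_sup_left (le_max_left m n) hm)
      (pow_le_pow_of_one_le le_sup_left (le_max_right m n) hn)⟩
  | mul y z _ _ hy hz =>
    obtain ⟨m, hm⟩ := hy
    obtain ⟨n, hn⟩ := hz
    exact ⟨m + n, by rw [pow_add]; exact Submodule.mul_mem_mul hm hn⟩

theorem exists_le_pow {U F : Submodule ℂ A} (hU : 1 ≤ U) (hU' : ∀ y, ∃ n, y ∈ U ^ n)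
    (hF : F.FG) : ∃ n, F ≤ U ^ n := by
  obtain ⟨s, rfl⟩ := hF
  choose n hn using hU'
  refine ⟨s.sup n, Submodule.span_le.2 fun y hy => ?_⟩
  exact pow_le_pow_of_one_le hU (Finset.le_sup (Finset.mem_coe.1 hy)) (hn y)

theorem finiteDimensional_pow (U : Submodule ℂ A) [FiniteDimensional ℂ U] (n : ℕ) :
    FiniteDimensional ℂ ↥(U ^ n) :=
  Module.Finite.iff_fg.2 ((Module.Finite.iff_fg.1 ‹_›).pow n)

theorem fg_one_sup (V : Submodule ℂ A) [FiniteDimensional ℂ V] : (1 ⊔ V : Submodule ℂ A).FG := by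
  refine Submodule.FG.sup ?_ (Module.Finite.iff_fg.1 ‹_›)
  rw [Submodule.one_eq_span]
  exact Submodule.fg_span_singleton _

theorem finiteDimensional_powSum (V : Submodule ℂ A) [FiniteDimensional ℂ V] (n : ℕ) :
    FiniteDimensional ℂ ↥(powSum V n) :=
  have : FiniteDimensional ℂ ↥(1 ⊔ V) := Module.Finite.iff_fg.2 (fg_one_sup V)
  have := finiteDimensional_pow (1 ⊔ V) n
  Submodule.finiteDimensional_of_le (powSum_le_pow (U := 1 ⊔ V) le_sup_left le_sup_right n)

/-- If the sums stop growing at some stage, the scalars together with that sum are stable under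
multiplication by `V`, hence are the whole algebra, which would be finite-dimensional. -/
theorem growthFunction_lt_succ {V : Submodule ℂ A} [FiniteDimensional ℂ V]
    (hV : Algebra.adjoin ℂ (V : Set A) = ⊤) (hA : ¬ FiniteDimensional ℂ A) (n : ℕ) :
    growthFunction V n < growthFunction V (n + 1) := by
  have := finiteDimensional_powSum V n
  have := finiteDimensional_powSum V (n + 1)
  apply Submodule.finrank_lt_finrank_of_lt
  refine lt_of_le_of_ne (powSum_mono V (Nat.le_succ n)) fun heq => hA ?_
  have h1 : ∀ k, (1 ⊔ V) ^ k ≤ 1 ⊔ powSum V n := fun k => by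
    induction k with
    | zero => simp
    | succ k ih =>
      rw [pow_succ']
      refine (mul_le_mul' le_rfl ih).trans ?_
      rw [Submodule.sup_mul, one_mul, Submodule.mul_sup, mul_one]
      refine sup_le le_rfl (le_sup_of_le_right (sup_le ?_ ?_))
      · have h : V ≤ powSum V (n + 1) := by
          simpa using pow_le_powSum V le_rfl (by omega : 1 ≤ n + 1)
        exact h.trans heq.ge
      · exact (mul_powSum_le V n).trans heq.ge
  have h2 : (⊤ : Submodule ℂ A) = 1 ⊔ powSum V n := by
    refine (eq_top_iff.2 fun y _ => ?_).symm
    obtain ⟨k, hk⟩ := exists_mem_one_sup_pow hV y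
    exact h1 k hk
  have h3 := fg_one_sup (powSum V n)
  rw [← h2] at h3
  exact ⟨h3⟩

theorem growthFunction_add_one_le {V : Submodule ℂ A} [FiniteDimensional ℂ V]
    (hV : Algebra.adjoin ℂ (V : Set A) = ⊤) (hA : ¬ FiniteDimensional ℂ A) {m n : ℕ} (h : m < n) :
    growthFunction V m + 1 ≤ growthFunction V n :=
  Nat.succ_le_of_lt (strictMono_nat_of_lt_succ (growthFunction_lt_succ hV hA) h)

/-- A generating space need not contain `1`; adding the scalars costs at most one dimension, which
strict growth later absorbs. -/
theorem finrank_one_sup_pow_le (V : Submodule ℂ A) [FiniteDimensional ℂ V] (n : ℕ) :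
    Module.finrank ℂ ↥((1 ⊔ V) ^ n) ≤ growthFunction V n + 1 := by
  have := finiteDimensional_powSum V n
  have : FiniteDimensional ℂ ↥(1 ⊔ powSum V n) := Module.Finite.iff_fg.2 (fg_one_sup _)
  have h1 : FiniteDimensional ℂ ↥(1 : Submodule ℂ A) := by
    rw [Submodule.one_eq_span]; infer_instance
  have h2 : Module.finrank ℂ ↥(1 : Submodule ℂ A) ≤ 1 := by
    rw [Submodule.one_eq_span]
    exact (finrank_span_le_card _).trans (by simp)
  calc _ ≤ Module.finrank ℂ ↥(1 ⊔ powSum V n) := Submodule.finrank_mono (one_sup_pow_le V n)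
    _ ≤ Module.finrank ℂ ↥(1 : Submodule ℂ A) + Module.finrank ℂ ↥(powSum V n) :=
      Submodule.finrank_add_le_finrank_add_finrank _ _
    _ ≤ growthFunction V n + 1 := by rw [add_comm]; exact Nat.add_le_add_left h2 _

theorem growthFunction_zero (V : Submodule ℂ A) : growthFunction V 0 = 0 := by
  have h : powSum V 0 = ⊥ := eq_bot_iff.2 (iSup₂_le fun k hk => by
    rw [Finset.mem_Icc] at hk
    omega)
  change Module.finrank ℂ ↥(powSum V 0) = 0
  rw [h, finrank_bot]

variable {A' : Type*} [Ring A'] [Algebra ℂ A']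

theorem growthLE_of_finrank_pow_le {W : Submodule ℂ A} {W' : Submodule ℂ A'}
    [FiniteDimensional ℂ W] [FiniteDimensional ℂ W'] (hW : 1 ≤ W) (hWtop : ∀ y, ∃ n, y ∈ W ^ n)
    (hfr : ∀ n, Module.finrank ℂ ↥(W ^ n) ≤ Module.finrank ℂ ↥(W' ^ n))
    (hA' : ¬ FiniteDimensional ℂ A') (V : Submodule ℂ A) (V' : Submodule ℂ A')
    [FiniteDimensional ℂ V] [FiniteDimensional ℂ V']
    (hV' : Algebra.adjoin ℂ (V' : Set A') = ⊤) :
    GrowthLE (growthFunction V) (growthFunction V') := by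
  obtain ⟨k, hk⟩ := exists_le_pow hW hWtop (fg_one_sup V)
  obtain ⟨l, hl⟩ := exists_le_pow (le_sup_left (a := 1) (b := V')) (exists_mem_one_sup_pow hV')
    (Module.Finite.iff_fg.1 ‹FiniteDimensional ℂ W'›)
  -- The factor `l * k` comes from `1 ⊔ V ≤ W ^ k` and `W' ≤ (1 ⊔ V') ^ l`. The extra `1` gains a
  -- further dimension for `n > 0`; at `n = 0` the growth function is zero.
  refine ⟨l * k + 1, fun n => ?_⟩
  rcases Nat.eq_zero_or_pos n with rfl | hn
  · rw [growthFunction_zero]; exact Nat.zero_le _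
  have := finiteDimensional_pow W (k * n)
  have : FiniteDimensional ℂ ↥(1 ⊔ V') := Module.Finite.iff_fg.2 (fg_one_sup V')
  have := finiteDimensional_pow (1 ⊔ V') (l * k * n)
  calc growthFunction V n ≤ Module.finrank ℂ ↥(W ^ (k * n)) := by
        refine Submodule.finrank_mono
          ((powSum_le_pow (U := 1 ⊔ V) le_sup_left le_sup_right n).trans ?_)
        rw [pow_mul]
        exact pow_le_pow_left' hk n
    _ ≤ Module.finrank ℂ ↥(W' ^ (k * n)) := hfr _
    _ ≤ Module.finrank ℂ ↥((1 ⊔ V') ^ (l * k * n)) := by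
        refine Submodule.finrank_mono ?_
        rw [mul_assoc, pow_mul _ l]
        exact pow_le_pow_left' hl _
    _ ≤ growthFunction V' (l * k * n) + 1 := finrank_one_sup_pow_le V' _
    _ ≤ growthFunction V' ((l * k + 1) * n) :=
        growthFunction_add_one_le hV' hA' (by rw [add_mul, one_mul]; omega)

/-- Algebras with filtrations by the powers of finite-dimensional subspaces that are spanned by
corresponding parts of bases have the same dimension and growth. -/
theorem sameDimensionAndGrowth_of_basis.{u} {A A' ι : Type u} [Ring A] [Algebra ℂ A] [Ring A']
    [Algebra ℂ A'] (b : Module.Basis ι ℂ A) (b' : Module.Basis ι ℂ A') (ℓ : ι → ℕ)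
    (W : Submodule ℂ A) (W' : Submodule ℂ A') [FiniteDimensional ℂ W] [FiniteDimensional ℂ W']
    (hW : 1 ≤ W) (hW' : 1 ≤ W') (hb : ∀ n, W ^ n = Submodule.span ℂ (b '' {i | ℓ i ≤ n}))
    (hb' : ∀ n, W' ^ n = Submodule.span ℂ (b' '' {i | ℓ i ≤ n})) :
    SameDimensionAndGrowth A A' := by
  set e : A ≃ₗ[ℂ] A' := b.equiv b' (Equiv.refl ι) with he
  refine ⟨e.rank_eq, fun hA V V' hVf hVf' hV hV' => ?_⟩
  have hA' : ¬ FiniteDimensional ℂ A' := fun h => hA (Module.Finite.equiv e.symm)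
  have hmap : ∀ n, (W ^ n).map (e : A →ₗ[ℂ] A') = W' ^ n := fun n => by
    rw [hb, hb', Submodule.map_span, Set.image_image]
    simp [he]
  have hfr : ∀ n, Module.finrank ℂ ↥(W ^ n) = Module.finrank ℂ ↥(W' ^ n) := fun n => by
    rw [← hmap n]
    exact (LinearEquiv.finrank_map_eq e _).symm
  have top : ∀ {C : Type u} [Ring C] [Algebra ℂ C] (c : Module.Basis ι ℂ C) (U : Submodule ℂ C),
      1 ≤ U → (∀ n, U ^ n = Submodule.span ℂ (c '' {i | ℓ i ≤ n})) → ∀ y, ∃ n, y ∈ U ^ n := by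
    intro C _ _ c U hU hc y
    refine ⟨(c.repr y).support.sup ℓ, ?_⟩
    rw [hc, Module.Basis.mem_span_image]
    exact fun i hi => Finset.le_sup (f := ℓ) (Finset.mem_coe.1 hi)
  exact ⟨growthLE_of_finrank_pow_le hW (top b W hW hb) (fun n => (hfr n).le) hA' V V' hV',
    growthLE_of_finrank_pow_le hW' (top b' W' hW' hb') (fun n => (hfr n).ge) hA V' V hV⟩

end Growth
-- The two presentations as instances of the rewriting system
section Presentations

open TraceMonoid

/-- The parameters `P` and `P'` are unrelated: both bases are indexed by the normal traces of `M`,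
with the same length function. -/
theorem IsTLFamily.sameDimensionAndGrowth.{u} {B A A' : Type u} [Finite B] [Ring A] [Algebra ℂ A]
    [Ring A'] [Algebra ℂ A'] {M : CoxeterMatrix B} {P P' : TLParams} {x : B → A} {x' : B → A'}
    (hx : IsTLFamily M P x) (hx' : IsTLFamily M P' x')
    (hgen : Algebra.adjoin ℂ (Set.range x) = ⊤) (hgen' : Algebra.adjoin ℂ (Set.range x') = ⊤)
    (ρ : A →ₐ[ℂ] Module.End ℂ ((TraceMonoid M →₀ ℂ) ⧸ relIdeal M P))
    (hρ : ∀ i, ρ (x i) = letterAction M P i)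
    (ρ' : A' →ₐ[ℂ] Module.End ℂ ((TraceMonoid M →₀ ℂ) ⧸ relIdeal M P'))
    (hρ' : ∀ i, ρ' (x' i) = letterAction M P' i) :
    SameDimensionAndGrowth A A' := by
  obtain ⟨b, hb⟩ := hx.exists_basis hgen ρ hρ
  obtain ⟨b', hb'⟩ := hx'.exists_basis hgen' ρ' hρ'
  have fin : ∀ {C : Type u} [Ring C] [Algebra ℂ C] (y : B → C),
      FiniteDimensional ℂ ↥(Submodule.span ℂ ({1} ∪ Set.range y)) := fun y =>
    FiniteDimensional.span_of_finite ℂ ((Set.finite_singleton 1).union (Set.finite_range y))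
  have one : ∀ {C : Type u} [Ring C] [Algebra ℂ C] (y : B → C),
      1 ≤ Submodule.span ℂ ({1} ∪ Set.range y) := fun y => by
    rw [Submodule.one_eq_span]
    exact Submodule.span_mono Set.subset_union_left
  have := fin x
  have := fin x'
  exact sameDimensionAndGrowth_of_basis b b' (fun t => len t.1) _ _ (one x) (one x') hb hb'

variable {B : Type*} {M : CoxeterMatrix B}

theorem IsRule.of_adj {i j : B} (h : (coxeterGraph M).Adj i j) (h0 : M i j ≠ 0) : IsRule M i j :=
  ⟨h.2, h0⟩

theorem IsRule.adj {i j : B} (h : IsRule M i j) (hij : i ≠ j) : (coxeterGraph M).Adj i j :=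
  ⟨hij, h.1⟩

theorem adjoin_range_eq_top_of_surjective {A : Type*} [Ring A] [Algebra ℂ A]
    {f : FreeAlgebra ℂ B →ₐ[ℂ] A} (hf : Function.Surjective f) :
    Algebra.adjoin ℂ (Set.range fun i => f (FreeAlgebra.ι ℂ i)) = ⊤ := by
  have h : Set.range (fun i => f (FreeAlgebra.ι ℂ i)) = f '' Set.range (FreeAlgebra.ι ℂ) :=
    Set.range_comp f _
  rw [h, ← AlgHom.map_adjoin, FreeAlgebra.adjoin_range_ι, Algebra.map_top]
  exact (AlgHom.range_eq_top f).2 hf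

theorem adjoin_range_add_one_eq_top_of_surjective {A : Type*} [Ring A] [Algebra ℂ A]
    {f : FreeAlgebra ℂ B →ₐ[ℂ] A} (hf : Function.Surjective f) :
    Algebra.adjoin ℂ (Set.range fun i => f (FreeAlgebra.ι ℂ i) + 1) = ⊤ := by
  rw [eq_top_iff, ← adjoin_range_eq_top_of_surjective hf, Algebra.adjoin_le_iff]
  rintro _ ⟨i, rfl⟩
  have h : f (FreeAlgebra.ι ℂ i) + 1 - 1 ∈
      Algebra.adjoin ℂ (Set.range fun i => f (FreeAlgebra.ι ℂ i) + 1) :=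
    Subalgebra.sub_mem _ (Algebra.subset_adjoin ⟨i, rfl⟩) (Subalgebra.one_mem _)
  rwa [add_sub_cancel_right] at h

/-- The parameters of the presentation by idempotents. -/
noncomputable def projParams (τ : ℕ → ℕ → ℂ) : TLParams where
  c := 1
  -- The substitution is `e = m - 2 * k`; the bound `k ≤ (m - 1) / 2` corresponds to `e ≠ 0`.
  d m e := if e ≠ 0 ∧ (Even e ↔ Even m) then τ m ((m - e) / 2) else 0
  d_zero m := by simp
  parity m e h := by
    by_contra hc
    simp [hc] at h

theorem sum_projParams {A : Type*} [AddCommGroup A] [Module ℂ A] (τ : ℕ → ℕ → ℂ) (m : ℕ)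
    (f : ℕ → A) : ∑ e ∈ Finset.range m, (projParams τ).d m e • f e =
      ∑ k ∈ Finset.Icc 1 ((m - 1) / 2), τ m k • f (m - 2 * k) := by
  simp only [projParams, ite_smul, zero_smul]
  rw [← Finset.sum_filter]
  refine Finset.sum_nbij' (fun e => (m - e) / 2) (fun k => m - 2 * k) ?_ ?_ ?_ ?_ ?_
  · intro e he
    simp only [Finset.mem_filter, Finset.mem_range, Nat.even_iff] at he
    rw [Finset.mem_Icc]
    omega
  · intro k hk
    rw [Finset.mem_Icc] at hk
    simp only [Finset.mem_filter, Finset.mem_range, Nat.even_iff]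
    omega
  · intro e he
    simp only [Finset.mem_filter, Finset.mem_range, Nat.even_iff] at he
    omega
  · intro k hk
    rw [Finset.mem_Icc] at hk
    omega
  · intro e he
    simp only [Finset.mem_filter, Finset.mem_range, Nat.even_iff] at he
    congr 2
    omega

/-- The generator `p i` of the algebra presented by idempotents. -/
noncomputable def projGen (M : CoxeterMatrix B) (τ : ℕ → ℕ → ℂ) (i : B) : TLProjAlgebra M τ :=
  RingQuot.mkAlgHom ℂ (TLProjRel M τ) (FreeAlgebra.ι ℂ i)

theorem isTLFamily_of_projRel {A : Type*} [Ring A] [Algebra ℂ A] {τ : ℕ → ℕ → ℂ}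
    {f : FreeAlgebra ℂ B →ₐ[ℂ] A} (hf : ∀ x y, TLProjRel M τ x y → f x = f y) :
    IsTLFamily M (projParams τ) fun i => f (FreeAlgebra.ι ℂ i) where
  quadratic i := by
    have := hf _ _ (TLProjRel.idem i)
    rw [map_mul] at this
    exact this.trans (one_smul _ _).symm
  comm i j h := by
    have := hf _ _ (TLProjRel.comm i j fun hc => hc.2 h)
    rwa [map_mul, map_mul] at this
  edge i j hij h := by
    have := hf _ _ (TLProjRel.edge i j (h.adj hij) h.2)
    simp only [map_sum, map_smul, map_altProd] at this
    rw [this, sum_projParams]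

theorem IsTLFamily.lift_eq_of_projRel {A : Type*} [Ring A] [Algebra ℂ A] {τ : ℕ → ℕ → ℂ}
    {x : B → A} (hx : IsTLFamily M (projParams τ) x) ⦃y z : FreeAlgebra ℂ B⦄
    (h : TLProjRel M τ y z) : FreeAlgebra.lift ℂ x y = FreeAlgebra.lift ℂ x z := by
  rcases h with ⟨i⟩ | ⟨i, j, h⟩ | ⟨i, j, h, h0⟩
  · rw [map_mul, FreeAlgebra.lift_ι_apply, hx.quadratic]
    exact one_smul _ _
  · rw [map_mul, map_mul, FreeAlgebra.lift_ι_apply, FreeAlgebra.lift_ι_apply]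
    by_cases hij : i = j
    · rw [hij]
    · exact hx.comm i j (not_not.1 fun h2 => h ⟨hij, h2⟩)
  · simp only [map_sum, map_smul, map_altProd, FreeAlgebra.lift_ι_apply]
    rw [hx.edge i j h.1 (IsRule.of_adj h h0), sum_projParams]

theorem isTLFamily_projGen (τ : ℕ → ℕ → ℂ) : IsTLFamily M (projParams τ) (projGen M τ) :=
  isTLFamily_of_projRel fun _ _ h => RingQuot.mkAlgHom_rel ℂ h

theorem exists_algHom_projGen (τ : ℕ → ℕ → ℂ) :
    ∃ ρ : TLProjAlgebra M τ →ₐ[ℂ]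
        Module.End ℂ ((TraceMonoid M →₀ ℂ) ⧸ relIdeal M (projParams τ)),
      ∀ i, ρ (projGen M τ i) = letterAction M (projParams τ) i :=
  ⟨RingQuot.liftAlgHom ℂ ⟨FreeAlgebra.lift ℂ (letterAction M (projParams τ)),
    isTLFamily_letterAction.lift_eq_of_projRel⟩, fun i => by
      rw [projGen, RingQuot.liftAlgHom_mkAlgHom_apply, FreeAlgebra.lift_ι_apply]⟩

/-- The coefficients of `dihedralSum (b - 1) (b' - 1) m` in the alternating products of `b` and
`b'`, for `b - 1` and `b' - 1` subject to the quadratic relation of the Hecke algebra. -/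
def klCoeff (q : ℂ) : ℕ → ℕ → ℂ
  | 0, _ => 0
  | 1, e => if e = 1 then 1 else 0
  | _ + 2, 0 => 0
  | m + 2, e + 1 => klCoeff q (m + 1) e - q * klCoeff q m (e + 1)

theorem klCoeff_zero (q : ℂ) (m : ℕ) : klCoeff q m 0 = 0 := by
  rcases m with _ | _ | m <;> simp [klCoeff]

theorem klCoeff_eq_zero_of_lt (q : ℂ) {m e : ℕ} (h : m < e) : klCoeff q m e = 0 := by
  induction m using Nat.twoStepInduction generalizing e with
  | zero => rfl
  | one =>
    have : e ≠ 1 := by omega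
    simp [klCoeff, this]
  | more m ih ih' =>
    obtain ⟨e, rfl⟩ := Nat.exists_eq_add_of_le' (Nat.one_le_of_lt h)
    rw [klCoeff, ih' (by omega), ih (by omega), mul_zero, sub_zero]

theorem klCoeff_self (q : ℂ) {m : ℕ} (h : 1 ≤ m) : klCoeff q m m = 1 := by
  induction m, h using Nat.le_induction with
  | base => simp [klCoeff]
  | succ m h ih =>
    obtain ⟨m, rfl⟩ := Nat.exists_eq_add_of_le' h
    rw [klCoeff, ih, klCoeff_eq_zero_of_lt q (by omega), mul_zero, sub_zero]

theorem klCoeff_parity (q : ℂ) {m e : ℕ} (h : klCoeff q m e ≠ 0) : Even e ↔ Even m := by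
  contrapose! h
  induction m using Nat.twoStepInduction generalizing e with
  | zero => rfl
  | one =>
    have : e ≠ 1 := by
      rintro rfl
      simp at h
    simp [klCoeff, this]
  | more m ih ih' =>
    rcases e with _ | e
    · rfl
    · simp only [Nat.even_iff] at h ih ih'
      rw [klCoeff, ih' (by omega), ih (by omega), mul_zero, sub_zero]

/-- The parameters of the presentation by the elements `t i + 1` of the Hecke algebra. -/
noncomputable def heckeParams (q : ℂ) : TLParams where
  c := q + 1
  d m e := -klCoeff q m e
  d_zero m := by rw [klCoeff_zero, neg_zero]
  parity m e h := klCoeff_parity q (neg_ne_zero.1 h)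

/-! ### Dihedral sums in the generators `t i + 1` -/

section DihedralSum

variable {A : Type*} [Ring A] [Algebra ℂ A]

theorem dihedralSum_eq {A : Type*} [Ring A] (s t : A) {m : ℕ} (hm : 1 ≤ m) :
    dihedralSum s t m = ∑ k ∈ Finset.range (m + 1), altProd s t k +
      ∑ k ∈ Finset.range m, altProd t s k - 1 := by
  obtain ⟨m, rfl⟩ := Nat.exists_eq_add_of_le' hm
  have h : Finset.Icc 1 (m + 1 - 1) = Finset.Ico 1 (m + 1) := by
    ext; simp
  rw [dihedralSum, h, Finset.sum_add_distrib, Finset.sum_range_succ _ (m + 1),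
    Finset.range_eq_Ico, Finset.sum_eq_sum_Ico_succ_bot (Nat.succ_pos m),
    Finset.sum_eq_sum_Ico_succ_bot (Nat.succ_pos m)]
  simp only [altProd, zero_add]
  abel

/-- Write `D m` for the left-hand side. Since `(s + 1) * s = q • (s + 1)`, the dihedral
Kazhdan–Lusztig recursion `(s + 1) * D (m + 1) = D (m + 2) + q • D m` holds, with `s` and `t`
exchanged in `D (m + 1)`; it is the recursion defining `klCoeff`. The braid relation is not needed.
-/
theorem sum_altProd_eq_sum_klCoeff (q : ℂ) (m : ℕ) {s t : A}
    (hs : s * s = (q - 1) • s + algebraMap ℂ A q) (ht : t * t = (q - 1) • t + algebraMap ℂ A q) :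
    ∑ k ∈ Finset.range (m + 1), altProd s t k + ∑ k ∈ Finset.range m, altProd t s k - 1 =
      ∑ e ∈ Finset.range (m + 1), klCoeff q m e • altProd (s + 1) (t + 1) e := by
  induction m using Nat.twoStepInduction generalizing s t with
  | zero => simp [altProd, klCoeff]
  | one => simp [Finset.sum_range_succ, altProd, klCoeff, add_comm]
  | more m ih ih' =>
    have h1 : ∀ n, s * ∑ k ∈ Finset.range n, altProd t s k =
        ∑ k ∈ Finset.range (n + 1), altProd s t k - 1 := fun n => by
      rw [Finset.sum_range_succ', Finset.mul_sum]
      simp [altProd]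
    have h2 : (s + 1) * s = q • (s + 1) := by
      rw [add_mul, hs, Algebra.algebraMap_eq_smul_one, one_mul, smul_add, sub_smul, one_smul]
      abel
    have h3 : ∀ n, (s + 1) * (∑ k ∈ Finset.range (n + 1), altProd s t k - 1) =
        q • (∑ k ∈ Finset.range (n + 1), altProd s t k +
          ∑ k ∈ Finset.range n, altProd t s k - 1) := fun n => by
      rw [← h1, ← mul_assoc, h2, smul_mul_assoc, add_mul, h1, one_mul]
      congr 1
      abel
    have h4 : (s + 1) * (∑ k ∈ Finset.range (m + 1 + 1), altProd t s k +
        ∑ k ∈ Finset.range (m + 1), altProd s t k - 1) =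
        (∑ k ∈ Finset.range (m + 2 + 1), altProd s t k +
          ∑ k ∈ Finset.range (m + 2), altProd t s k - 1) +
        q • (∑ k ∈ Finset.range (m + 1), altProd s t k +
          ∑ k ∈ Finset.range m, altProd t s k - 1) := by
      rw [add_sub_assoc, mul_add, h3, add_mul, h1, one_mul]
      abel
    rw [ih hs ht, ih' ht hs, ← sub_eq_iff_eq_add] at h4
    rw [← h4, Finset.sum_range_succ' _ (m + 2), klCoeff_zero, zero_smul, add_zero]
    -- The sum can be shifted by one and extended because `klCoeff q m` vanishes at `0` and above
    -- `m`.
    have h5 : ∑ e ∈ Finset.range (m + 1), klCoeff q m e • altProd (s + 1) (t + 1) e =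
        ∑ e ∈ Finset.range (m + 2), klCoeff q m (e + 1) • altProd (s + 1) (t + 1) (e + 1) := by
      rw [← add_zero (∑ e ∈ Finset.range (m + 2), _),
        ← zero_smul ℂ (altProd (s + 1) (t + 1) 0), ← klCoeff_zero q m,
        ← Finset.sum_range_succ' (fun e => klCoeff q m e • altProd (s + 1) (t + 1) e),
        Finset.sum_range_succ _ (m + 2), Finset.sum_range_succ _ (m + 1),
        klCoeff_eq_zero_of_lt q (by omega : m < m + 2),
        klCoeff_eq_zero_of_lt q (by omega : m < m + 1)]
      simp
    rw [h5, Finset.smul_sum, Finset.mul_sum, ← Finset.sum_sub_distrib]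
    refine Finset.sum_congr rfl fun e _ => ?_
    rw [klCoeff, sub_smul, mul_smul, mul_smul_comm]
    rfl

theorem dihedralSum_eq_sub (q : ℂ) {m : ℕ} (hm : 1 ≤ m) {s t : A}
    (hs : s * s = (q - 1) • s + algebraMap ℂ A q) (ht : t * t = (q - 1) • t + algebraMap ℂ A q) :
    dihedralSum s t m = altProd (s + 1) (t + 1) m -
      ∑ e ∈ Finset.range m, (heckeParams q).d m e • altProd (s + 1) (t + 1) e := by
  rw [dihedralSum_eq s t hm, sum_altProd_eq_sum_klCoeff q m hs ht, Finset.sum_range_succ,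
    klCoeff_self q hm, one_smul, add_comm]
  simp [heckeParams]

theorem map_dihedralSum {A A' F : Type*} [Ring A] [Ring A'] [FunLike F A A'] [RingHomClass F A A'] (f : F)
    (s t : A) (m : ℕ) : f (dihedralSum s t m) = dihedralSum (f s) (f t) m := by
  simp only [dihedralSum, map_add, map_one, map_sum, map_altProd]

theorem isTLFamily_of_dihedralSum {q : ℂ} {t : B → A}
    (hq : ∀ i, t i * t i = (q - 1) • t i + algebraMap ℂ A q)
    (hc : ∀ i j, M i j = 2 → t i * t j = t j * t i)
    (hd : ∀ i j, i ≠ j → IsRule M i j → dihedralSum (t i) (t j) (M i j) = 0) :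
    IsTLFamily M (heckeParams q) fun i => t i + 1 where
  quadratic i := by
    rw [add_mul, mul_add, hq, Algebra.algebraMap_eq_smul_one, mul_one, one_mul]
    change _ = (q + 1) • (t i + 1)
    module
  comm i j h := by
    simp only [add_mul, mul_add, mul_one, one_mul, hc i j h]
    abel
  edge i j hij h := by
    rw [← sub_eq_zero, ← dihedralSum_eq_sub q (Nat.one_le_iff_ne_zero.2 h.2) (hq i) (hq j)]
    exact hd i j hij h

theorem IsTLFamily.sub_one_mul_self {q : ℂ} {x : B → A} (hx : IsTLFamily M (heckeParams q) x)
    (i : B) : (x i - 1) * (x i - 1) = (q - 1) • (x i - 1) + algebraMap ℂ A q := by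
  rw [sub_mul, mul_sub, hx.quadratic, Algebra.algebraMap_eq_smul_one, mul_one, one_mul]
  change (q + 1) • x i - x i - (x i - 1) = _
  module

theorem IsTLFamily.dihedralSum_eq_zero {q : ℂ} {x : B → A} (hx : IsTLFamily M (heckeParams q) x)
    {i j : B} (hij : i ≠ j) (h : IsRule M i j) :
    dihedralSum (x i - 1) (x j - 1) (M i j) = 0 := by
  rw [dihedralSum_eq_sub q (Nat.one_le_iff_ne_zero.2 h.2) (hx.sub_one_mul_self i)
    (hx.sub_one_mul_self j), sub_eq_zero, sub_add_cancel, sub_add_cancel]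
  exact hx.edge i j hij h

/-- For an edge, the dihedral sums of `(i, j)` and `(j, i)` both vanish and differ only in the
longest term; their difference is the braid relation. -/
theorem IsTLFamily.lift_eq_of_heckeRel {q : ℂ} {x : B → A} (hx : IsTLFamily M (heckeParams q) x)
    ⦃y z : FreeAlgebra ℂ B⦄ (h : HeckeRel M q y z) :
    FreeAlgebra.lift ℂ (fun i => x i - 1) y = FreeAlgebra.lift ℂ (fun i => x i - 1) z := by
  rcases h with ⟨i⟩ | ⟨i, j, hij, h0⟩
  · simp only [map_mul, map_add, map_smul, AlgHom.commutes, FreeAlgebra.lift_ι_apply,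
      hx.sub_one_mul_self]
  · simp only [map_altProd, FreeAlgebra.lift_ι_apply]
    by_cases h2 : M i j = 2
    · rw [h2]
      simp only [altProd, mul_one, sub_mul, mul_sub, one_mul, hx.comm i j h2]
      abel
    · have h3 := hx.dihedralSum_eq_zero hij ⟨h2, h0⟩
      have h4 := hx.dihedralSum_eq_zero hij.symm (IsRule.symm ⟨h2, h0⟩)
      rw [M.symmetric j i] at h4
      simp only [dihedralSum,
        add_comm (altProd (x j - 1) (x i - 1) _) (altProd (x i - 1) (x j - 1) _)] at h3 h4
      exact add_left_cancel (h3.trans h4.symm)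

theorem isTLFamily_of_tlRel {q : ℂ} {f : FreeAlgebra ℂ B →ₐ[ℂ] HeckeAlgebra M q}
    {g : HeckeAlgebra M q →ₐ[ℂ] A} (hfι : ∀ i, f (FreeAlgebra.ι ℂ i) = heckeGen M q i)
    (hf : ∀ x y, HeckeRel M q x y → f x = f y) (hg : ∀ x y, TLRel M q x y → g x = g y) :
    IsTLFamily M (heckeParams q) fun i => g (heckeGen M q i) + 1 := by
  have hgf : ∀ x y, HeckeRel M q x y → g.comp f x = g.comp f y := fun x y h =>
    congrArg g (hf x y h)
  have hι : ∀ i, g.comp f (FreeAlgebra.ι ℂ i) = g (heckeGen M q i) := fun i => congrArg g (hfι i)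
  refine isTLFamily_of_dihedralSum (fun i => ?_) (fun i j h => ?_) fun i j hij h => ?_
  · have := hgf _ _ (HeckeRel.quadratic i)
    rwa [map_mul, map_add, map_smul, AlgHom.commutes, hι] at this
  · have hij : i ≠ j := by
      rintro rfl
      simp at h
    have := hgf _ _ (HeckeRel.braid i j hij (by omega))
    rw [h, map_altProd, map_altProd, hι, hι] at this
    simpa only [altProd, mul_one] using this
  · have := hg _ _ (TLRel.edge i j (h.adj hij) h.2)
    rw [map_zero] at this
    rw [← this]
    exact (map_dihedralSum g _ _ _).symm

end DihedralSum

/-- The image of the generator `t i` of the Hecke algebra in the Temperley-Lieb algebra. -/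
noncomputable def tlGen (M : CoxeterMatrix B) (q : ℂ) (i : B) : TLAlgebra M q :=
  RingQuot.mkAlgHom ℂ (TLRel M q) (heckeGen M q i)

theorem isTLFamily_tlGen (q : ℂ) : IsTLFamily M (heckeParams q) fun i => tlGen M q i + 1 := by
  have h := @isTLFamily_of_tlRel B M (TLAlgebra M q) _ _ q (RingQuot.mkAlgHom ℂ (HeckeRel M q))
    (RingQuot.mkAlgHom ℂ (TLRel M q)) (fun _ => rfl)
    (fun _ _ h => RingQuot.mkAlgHom_rel ℂ h) (fun _ _ h => RingQuot.mkAlgHom_rel ℂ h)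
  exact h

theorem adjoin_range_tlGen (q : ℂ) :
    Algebra.adjoin ℂ (Set.range fun i => tlGen M q i + 1) = ⊤ := by
  have hs : Function.Surjective
      ((RingQuot.mkAlgHom ℂ (TLRel M q)).comp (RingQuot.mkAlgHom ℂ (HeckeRel M q))) :=
    (RingQuot.mkAlgHom_surjective ℂ _).comp (RingQuot.mkAlgHom_surjective ℂ _)
  have h := @adjoin_range_add_one_eq_top_of_surjective B (TLAlgebra M q) _ _ _ hs
  exact h

/-- The converse translation: `t i` is sent to `x i - 1`, first on the Hecke algebra and then on its
quotient by the dihedral sums. -/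
theorem IsTLFamily.exists_algHom_tlGen {A : Type*} [Ring A] [Algebra ℂ A] {q : ℂ} {x : B → A}
    (hx : IsTLFamily M (heckeParams q) x) :
    ∃ ρ : TLAlgebra M q →ₐ[ℂ] A, ∀ i, ρ (tlGen M q i + 1) = x i := by
  have hg : ∀ ⦃y z⦄, TLRel M q y z →
      RingQuot.liftAlgHom ℂ ⟨FreeAlgebra.lift ℂ fun i => x i - 1, hx.lift_eq_of_heckeRel⟩ y =
      RingQuot.liftAlgHom ℂ ⟨FreeAlgebra.lift ℂ fun i => x i - 1, hx.lift_eq_of_heckeRel⟩ z := by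
    rintro _ _ ⟨i, j, h, h0⟩
    refine (map_dihedralSum _ _ _ _).trans (Eq.trans ?_ (map_zero _).symm)
    rw [heckeGen, heckeGen, RingQuot.liftAlgHom_mkAlgHom_apply,
      RingQuot.liftAlgHom_mkAlgHom_apply, FreeAlgebra.lift_ι_apply, FreeAlgebra.lift_ι_apply]
    exact hx.dihedralSum_eq_zero h.1 (IsRule.of_adj h h0)
  refine ⟨RingQuot.liftAlgHom ℂ ⟨_, hg⟩, fun i => ?_⟩
  rw [map_add, map_one, tlGen, RingQuot.liftAlgHom_mkAlgHom_apply, heckeGen,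
    RingQuot.liftAlgHom_mkAlgHom_apply, FreeAlgebra.lift_ι_apply, sub_add_cancel]

end Presentations

theorem mainTheorem2 {B : Type*} [Finite B] (M : CoxeterMatrix B)
    (hΓ : (coxeterGraph M).Connected) :
    (∀ q q' : ℂ, SameDimensionAndGrowth (TLAlgebra M q) (TLAlgebra M q')) ∧
    (∀ τ τ' : ℕ → ℕ → ℂ,
      SameDimensionAndGrowth (TLProjAlgebra M τ) (TLProjAlgebra M τ')) := by
  constructor
  · intro q q'
    obtain ⟨ρ, hρ⟩ := isTLFamily_letterAction.exists_algHom_tlGen (M := M) (q := q)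
    obtain ⟨ρ', hρ'⟩ := isTLFamily_letterAction.exists_algHom_tlGen (M := M) (q := q')
    exact (isTLFamily_tlGen q).sameDimensionAndGrowth (isTLFamily_tlGen q') (adjoin_range_tlGen q)
      (adjoin_range_tlGen q') ρ hρ ρ' hρ'
  · intro τ τ'
    obtain ⟨ρ, hρ⟩ := exists_algHom_projGen (M := M) τ
    obtain ⟨ρ', hρ'⟩ := exists_algHom_projGen (M := M) τ'
    exact (isTLFamily_projGen τ).sameDimensionAndGrowth (isTLFamily_projGen τ')
      (adjoin_range_eq_top_of_surjective (RingQuot.mkAlgHom_surjective ℂ _))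
      (adjoin_range_eq_top_of_surjective (RingQuot.mkAlgHom_surjective ℂ _)) ρ hρ ρ' hρ'
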